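/- Let $1\le q\le n-2$. On the Heisenberg group $\mathbb H^n=\mathbb R_t\times\mathbb C^n_z$ put $s=|z|^2$, $w=t+is$, $\bar L_k=\partial_{\bar z^k}-iz^k\partial_t$, and let $\Omega=\{(t,z): |w|\le 1\}$ be the closed unit ball. Let $L^2_{(0,r)}(\Omega)$ be the Hilbert space of $(0,r)$-forms $f=\sum_{|J|=r}f_J\,d\bar z^J$ with square-integrable coefficients (with respect to Lebesgue measure, the $d\bar z^J$ being orthonormal). Let $\bar\partial_b\colon L^2_{(0,r)}(\Omega)\to L^2_{(0,r+1)}(\Omega)$ be the maximal (distributional) extension of $\bar\partial_b f=\sum_{k,J}(\bar L_kf_J)\,d\bar z^k\wedge d\bar z^J$, let $\bar\partial_b^*$ be its $L^2$-adjoint, and let $\square_b=\bar\partial_b\bar\partial_b^*+\bar\partial_b^*\bar\partial_b$ on $L^2_{(0,q)}(\Omega)$ with domain $\{u\in\operatorname{dom}\bar\partial_b\cap\operatorname{dom}\bar\partial_b^*:\ \bar\partial_bu\in\operatorname{dom}\bar\partial_b^*,\ \bar\partial_b^*u\in\operatorname{dom}\bar\partial_b\}$. Then the Neumann operator $N_b$,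 that is, the bounded operator $N_b\colon L^2_{(0,q)}(\Omega)\to\operatorname{dom}\square_b\subset L^2_{(0,q)}(\Omega)$ with $\square_bN_b=\mathrm{Id}$ on $L^2_{(0,q)}(\Omega)$ and $N_b\square_b=\mathrm{Id}$ on $\operatorname{dom}\square_b$, is not compact. Moreover, put $h_k(\zeta)=\sqrt{8k+2}\,\zeta^{4k}$ for $k\ge 0$ and $$u_{h_k}=h_k(w)\,\frac{(z^n)^l}{s^{q+1}}\sum_{j=1}^{q+1}(-1)^{j-1}\bar z^j\,d\bar z^{\{1,\dots,q+1\}\setminus\{j\}} .$$ For every sufficiently large integer $l$, all the forms $u_{h_k}$ lie in $\operatorname{dom}\square_b$, the sequence $(\square_bu_{h_k})_k$ is bounded in $L^2_{(0,q)}(\Omega)$, and $(u_{h_k})_k$ has no subsequence converging in $L^2_{(0,q)}(\Omega)$. -/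

import Mathlib

open MeasureTheory Filter Topology
open scoped ContDiff ComplexConjugate

noncomputable section

namespace Heisenberg

/-- The underlying manifold `ℝ_t × ℂⁿ_z` of the `(2n+1)`-dimensional Heisenberg group `ℍⁿ`,
with points `p = (t, z)`; Lebesgue measure is its Haar measure. -/
abbrev Heis (n : ℕ) : Type := ℝ × (Fin n → ℂ)

/-- `s = |z|²` (Euclidean norm). -/
def sFun {n : ℕ} (p : Heis n) : ℝ := ∑ k, ‖p.2 k‖ ^ 2

/-- `w = t + i |z|²`. -/
def wFun {n : ℕ} (p : Heis n) : ℂ := (p.1 : ℂ) + Complex.I * (sFun p : ℂ)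

/-- The closed unit ball `Ω = {|t + i|z|²| ≤ 1}` of the Heisenberg group. -/
def ball (n : ℕ) : Set (Heis n) := {p | ‖wFun p‖ ≤ 1}

/-- Lebesgue measure on `Ω`. -/
def ballMeasure (n : ℕ) : Measure (Heis n) := volume.restrict (ball n)

/-- The derivative `∂φ/∂t`. -/
def partialT {n : ℕ} (φ : Heis n → ℂ) (p : Heis n) : ℂ := fderiv ℝ φ p (1, 0)

/-- The Wirtinger derivative `∂φ/∂z̄ᵏ = ½ (∂φ/∂xᵏ + i ∂φ/∂yᵏ)`. -/
def partialZbar {n : ℕ} (k : Fin n) (φ : Heis n → ℂ) (p : Heis n) : ℂ :=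
  (1 / 2 : ℂ) * (fderiv ℝ φ p (0, Pi.single k 1) +
    Complex.I * fderiv ℝ φ p (0, Pi.single k Complex.I))

/-- The vector field `L̄_k = ∂/∂z̄ᵏ - i zᵏ ∂/∂t`, conjugate to `L_k = ∂/∂zᵏ + i z̄ᵏ ∂/∂t`. -/
def Lbar {n : ℕ} (k : Fin n) (φ : Heis n → ℂ) (p : Heis n) : ℂ :=
  partialZbar k φ p - Complex.I * p.2 k * partialT φ p

/-- Increasing multi-indices `J ⊆ {1, …, n}` of length `q`. -/
abbrev MultiIndex (n q : ℕ) : Type := {J : Finset (Fin n) // J.card = q}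

/-- `J \ {k}` for `k ∈ J`. -/
def MultiIndex.erase {n q : ℕ} (J : MultiIndex n (q + 1)) (k : {k // k ∈ J.1}) :
    MultiIndex n q :=
  ⟨J.1.erase k.1, by rw [Finset.card_erase_of_mem k.2, J.2]; rfl⟩

/-- The sign `(-1)^{#{j ∈ J : j < k}}`. For `k ∈ J` one has
`dz̄ᵏ ∧ dz̄^{J \ k} = sign k J • dz̄^J`. -/
def sign {n : ℕ} (k : Fin n) (J : Finset (Fin n)) : ℂ :=
  (-1) ^ (J.filter (fun j => j < k)).card

/-- The Hilbert space `L²_{(0,q)}(Ω)` of square-integrable `(0,q)`-forms `f = ∑_J f_J dz̄^J` on `Ω`,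
the sum being over increasing multi-indices of length `q`; a form is the vector of its coefficients
and the forms `dz̄^J` are pointwise orthonormal. -/
abbrev L2Form (n q : ℕ) : Type :=
  Lp (EuclideanSpace ℂ (MultiIndex n q)) 2 (ballMeasure n)

/-- Scalar test functions: smooth, with compact support inside the interior of `Ω`. -/
structure IsTest {n : ℕ} (φ : Heis n → ℂ) : Prop where
  smooth : ContDiff ℝ ∞ φ
  compact : HasCompactSupport φ
  supp : tsupport φ ⊆ interior (ball n)

/-- `∂̄_b f = g` in the sense of distributions on the interior of `Ω`: for every multi-index `K`
of length `q + 1`, `g_K = ∑_{k ∈ K} sign k K • L̄_k f_{K \ k}` weakly. (The vector field `L̄_k` is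
divergence free, so its formal transpose is `-L̄_k`.) -/
def IsWeakDbar {n q : ℕ} (f : L2Form n q) (g : L2Form n (q + 1)) : Prop :=
  ∀ (K : MultiIndex n (q + 1)) (φ : Heis n → ℂ), IsTest φ →
    ∫ p, g p K * φ p ∂(ballMeasure n) =
      -∑ k : {k // k ∈ K.1}, sign k.1 K.1 *
        ∫ p, f p (K.erase k) * Lbar k.1 φ p ∂(ballMeasure n)

lemma continuous_sFun {n : ℕ} : Continuous (sFun (n := n)) := by
  unfold sFun; fun_prop

lemma mem_ball_iff {n : ℕ} (p : Heis n) : p ∈ ball n ↔ p.1 ^ 2 + sFun p ^ 2 ≤ 1 := by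
  have h : ‖wFun p‖ ^ 2 = p.1 ^ 2 + sFun p ^ 2 := by
    rw [← Complex.normSq_eq_norm_sq, wFun, mul_comm, Complex.normSq_add_mul_I]
  rw [← h, ball, Set.mem_ofPred_eq]
  exact (sq_le_one_iff₀ (norm_nonneg _)).symm

lemma isClosed_ball (n : ℕ) : IsClosed (ball n) := by
  have : ball n = {p | p.1 ^ 2 + sFun p ^ 2 ≤ 1} := Set.ext mem_ball_iff
  rw [this]
  have := continuous_sFun (n := n)
  exact isClosed_le (by fun_prop) continuous_const

lemma convex_ball (n : ℕ) : Convex ℝ (ball n) := by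
  have : ball n = {p ∈ Set.univ | p.1 ^ 2 + sFun p ^ 2 ≤ 1} := by
    ext p; simp [mem_ball_iff]
  rw [this]
  have h1 : ConvexOn ℝ Set.univ (fun p : Heis n => p.1 ^ 2) :=
    (even_two.convexOn_pow (𝕜 := ℝ)).comp_linearMap (LinearMap.fst ℝ ℝ (Fin n → ℂ))
  have h2 : ConvexOn ℝ Set.univ (sFun (n := n)) := by
    have hk : ∀ k : Fin n, ConvexOn ℝ Set.univ (fun p : Heis n => ‖p.2 k‖ ^ 2) := fun k =>
      (convexOn_univ_norm.comp_linearMap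
        ((LinearMap.proj k).comp (LinearMap.snd ℝ ℝ (Fin n → ℂ)))).pow
          (fun _ _ => norm_nonneg _) 2
    have := Finset.sum_induction (fun k (p : Heis n) => ‖p.2 k‖ ^ 2)
      (fun g => ConvexOn ℝ Set.univ g) (fun _ _ => ConvexOn.add)
      (convexOn_const 0 convex_univ) (s := Finset.univ) (fun k _ => hk k)
    convert this using 1
    ext p; simp [sFun]
  have h3 : ConvexOn ℝ Set.univ (fun p : Heis n => sFun p ^ 2) :=
    h2.pow (fun p _ => Finset.sum_nonneg fun k _ => by positivity) 2
  exact (h1.add h3).convex_le 1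

instance isAddHaarMeasure_volume (n : ℕ) :
    (volume : Measure (Heis n)).IsAddHaarMeasure :=
  Measure.prod.instIsAddHaarMeasure (volume : Measure ℝ) (volume : Measure (Fin n → ℂ))

instance isFiniteMeasure_ballMeasure (n : ℕ) : IsFiniteMeasure (ballMeasure n) := by
  have hb : Bornology.IsBounded (ball n) := by
    refine (Metric.isBounded_closedBall (x := (0 : Heis n)) (r := 1)).subset fun p hp => ?_
    rw [mem_ball_iff] at hp
    have hs : 0 ≤ sFun p := Finset.sum_nonneg fun k _ => by positivity
    have ht : |p.1| ≤ 1 := by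
      rw [← sq_le_one_iff_abs_le_one]; nlinarith [sq_nonneg (sFun p)]
    have hs1 : sFun p ≤ 1 := by nlinarith [sq_nonneg p.1]
    rw [mem_closedBall_zero_iff, Prod.norm_def, max_le_iff]
    refine ⟨ht, (pi_norm_le_iff_of_nonneg zero_le_one).2 fun k => ?_⟩
    have : ‖p.2 k‖ ^ 2 ≤ sFun p :=
      Finset.single_le_sum (f := fun k => ‖p.2 k‖ ^ 2) (fun k _ => by positivity)
        (Finset.mem_univ k)
    nlinarith [norm_nonneg (p.2 k)]
  exact ⟨by rw [ballMeasure, Measure.restrict_apply_univ]; exact hb.measure_lt_top⟩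

lemma integrable_coeff_mul {n q : ℕ} (f : L2Form n q) (J : MultiIndex n q) {ψ : Heis n → ℂ}
    (hψ : Continuous ψ) (hc : HasCompactSupport ψ) :
    Integrable (fun p => f p J * ψ p) (ballMeasure n) := by
  have h1 : MemLp (fun p => f p J) 2 (ballMeasure n) :=
    (EuclideanSpace.proj (𝕜 := ℂ) J : _ →L[ℂ] ℂ).comp_memLp' (Lp.memLp f)
  obtain ⟨C, hC⟩ := hψ.bounded_above_of_compact_support hc
  exact (h1.integrable one_le_two).mul_bdd hψ.aestronglyMeasurable (ae_of_all _ hC)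

lemma IsTest.integrable_mul {n q : ℕ} {φ : Heis n → ℂ} (hφ : IsTest φ) (f : L2Form n q)
    (J : MultiIndex n q) : Integrable (fun p => f p J * φ p) (ballMeasure n) :=
  integrable_coeff_mul f J hφ.smooth.continuous hφ.compact

lemma IsTest.integrable_mul_Lbar {n q : ℕ} {φ : Heis n → ℂ} (hφ : IsTest φ) (f : L2Form n q)
    (J : MultiIndex n q) (k : Fin n) :
    Integrable (fun p => f p J * Lbar k φ p) (ballMeasure n) := by
  refine integrable_coeff_mul f J ?_ ?_
  · have := hφ.smooth.continuous_fderiv (by simp)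
    unfold Lbar partialZbar partialT
    fun_prop
  · refine (hφ.compact.fderiv (𝕜 := ℝ)).mono fun p hp hp0 => hp ?_
    simp [Lbar, partialZbar, partialT, hp0]

/-- The graph of the maximal extension of `∂̄_b` to `L²`: all pairs `(f, g)` of `L²` forms such that
`∂̄_b f = g` in the sense of distributions. -/
def dbarGraph (n q : ℕ) : Submodule ℂ (L2Form n q × L2Form n (q + 1)) where
  carrier := {x | IsWeakDbar x.1 x.2}
  zero_mem' := by
    intro K φ _
    have h0 : ∀ r (J : MultiIndex n r) (ψ : Heis n → ℂ),
        ∫ p, (0 : L2Form n r) p J * ψ p ∂(ballMeasure n) = 0 := by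
      intro r J ψ
      refine integral_eq_zero_of_ae ?_
      filter_upwards [Lp.coeFn_zero (EuclideanSpace ℂ (MultiIndex n r)) 2 (ballMeasure n)] with p hp
      rw [hp]; simp
    simp only [Prod.fst_zero, Prod.snd_zero, h0]
    simp
  add_mem' := by
    intro x y hx hy K φ hφ
    have ha : ∀ r (J : MultiIndex n r) (a b : L2Form n r) (ψ : Heis n → ℂ),
        Integrable (fun p => a p J * ψ p) (ballMeasure n) →
        Integrable (fun p => b p J * ψ p) (ballMeasure n) →
        ∫ p, (a + b) p J * ψ p ∂(ballMeasure n) =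
          ∫ p, a p J * ψ p ∂(ballMeasure n) + ∫ p, b p J * ψ p ∂(ballMeasure n) := by
      intro r J a b ψ h1 h2
      rw [← integral_add h1 h2]
      refine integral_congr_ae ?_
      filter_upwards [Lp.coeFn_add a b] with p hp
      rw [hp]; simp [add_mul]
    rw [Prod.fst_add, Prod.snd_add, ha _ _ _ _ _ (hφ.integrable_mul _ _) (hφ.integrable_mul _ _),
      hx K φ hφ, hy K φ hφ, ← neg_add, ← Finset.sum_add_distrib]
    congr 1
    refine Finset.sum_congr rfl fun k _ => ?_
    rw [ha _ _ _ _ _ (hφ.integrable_mul_Lbar _ _ _) (hφ.integrable_mul_Lbar _ _ _), mul_add]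
  smul_mem' := by
    intro c x hx K φ hφ
    have hs : ∀ r (J : MultiIndex n r) (a : L2Form n r) (ψ : Heis n → ℂ),
        ∫ p, (c • a) p J * ψ p ∂(ballMeasure n) = c * ∫ p, a p J * ψ p ∂(ballMeasure n) := by
      intro r J a ψ
      rw [← integral_const_mul]
      refine integral_congr_ae ?_
      filter_upwards [Lp.coeFn_smul c a] with p hp
      rw [hp]; simp [mul_assoc]
    rw [Prod.smul_fst, Prod.smul_snd, hs, hx K φ hφ, mul_neg, Finset.mul_sum]
    congr 1
    refine Finset.sum_congr rfl fun k _ => ?_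
    rw [hs]; ring

/-- A weak `∂̄_b` is unique, so `dbarGraph` is the graph of an operator. -/
lemma dbarGraph_unique (n q : ℕ) (x : L2Form n q × L2Form n (q + 1)) (hx : x ∈ dbarGraph n q)
    (hx0 : x.1 = 0) : x.2 = 0 := by
  obtain ⟨f, g⟩ := x
  have hf : f = 0 := hx0
  subst hf
  change g = 0
  have hint : ∀ (K : MultiIndex n (q + 1)) (φ : Heis n → ℂ), IsTest φ →
      ∫ p, g p K * φ p ∂(ballMeasure n) = 0 := by
    intro K φ hφ
    have h1 := hx K φ hφ
    have h0 : ∀ (J : MultiIndex n q) (ψ : Heis n → ℂ),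
        ∫ p, (0 : L2Form n q) p J * ψ p ∂(ballMeasure n) = 0 := by
      intro J ψ
      refine integral_eq_zero_of_ae ?_
      filter_upwards [Lp.coeFn_zero (EuclideanSpace ℂ (MultiIndex n q)) 2 (ballMeasure n)] with p hp
      rw [hp]; simp
    simp only [h0] at h1
    simpa using h1
  have hae : ∀ᵐ p ∂(ballMeasure n), p ∈ interior (ball n) := by
    rw [ballMeasure, ae_restrict_iff' (isClosed_ball n).measurableSet]
    have h0 := (convex_ball n).addHaar_frontier volume
    filter_upwards [measure_eq_zero_iff_ae_notMem.1 h0] with p hp hpb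
    by_contra hi
    exact hp ((isClosed_ball n).frontier_eq ▸ ⟨hpb, hi⟩)
  have hK : ∀ K : MultiIndex n (q + 1), ∀ᵐ p ∂(ballMeasure n), g p K = 0 := by
    intro K
    have h1 : MemLp (fun p => g p K) 2 (ballMeasure n) :=
      (EuclideanSpace.proj (𝕜 := ℂ) K : _ →L[ℂ] ℂ).comp_memLp' (Lp.memLp g)
    have h2 := isOpen_interior.ae_eq_zero_of_integral_contDiff_smul_eq_zero (μ := ballMeasure n)
      (U := interior (ball n)) (f := fun p => g p K)
      ((h1.integrable one_le_two).locallyIntegrable.locallyIntegrableOn _)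
      (fun φ h1 h2 h3 => by
        have hsupp : tsupport (fun p => (φ p : ℂ)) ⊆ tsupport φ :=
          closure_mono fun p hp h => hp (by simp [h])
        have := hint K (fun p => (φ p : ℂ))
          ⟨Complex.ofRealCLM.contDiff.comp h1, h2.comp_left (g := Complex.ofReal) rfl,
            hsupp.trans h3⟩
        simpa [Complex.real_smul, mul_comm] using this)
    filter_upwards [h2, hae] with p hp hp' using hp hp'
  rw [Lp.eq_zero_iff_ae_eq_zero]
  filter_upwards [ae_all_iff.2 hK] with p hp
  ext K
  simpa using hp K

/-- The tangential Cauchy-Riemann operator `∂̄_b : L²_{(0,q)}(Ω) → L²_{(0,q+1)}(Ω)`, an unbounded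
operator with its maximal domain: all `L²` forms `f` whose distributional `∂̄_b f` is in `L²`. -/
def dbar (n q : ℕ) : L2Form n q →ₗ.[ℂ] L2Form n (q + 1) := (dbarGraph n q).toLinearPMap

/-- The operator `dbar` is the weak `∂̄_b`. -/
lemma dbar_graph (n q : ℕ) (f : L2Form n q) (g : L2Form n (q + 1)) :
    (f, g) ∈ (dbar n q).graph ↔ IsWeakDbar f g := by
  rw [dbar, Submodule.toLinearPMap_graph_eq _ (dbarGraph_unique n q)]
  rfl

section Hodge

variable {E F G : Type*} [NormedAddCommGroup E] [InnerProductSpace ℂ E] [CompleteSpace E]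
  [NormedAddCommGroup F] [InnerProductSpace ℂ F] [CompleteSpace F]
  [NormedAddCommGroup G] [InnerProductSpace ℂ G]

lemma pmap_add {A B : Type*} [AddCommGroup A] [Module ℂ A] [AddCommGroup B] [Module ℂ B]
    (T : A →ₗ.[ℂ] B) {x y z : T.domain} (h : (x : A) = y + z) : T x = T y + T z := by
  rw [← T.map_add]; exact congrArg T (Subtype.ext h)

lemma pmap_smul {A B : Type*} [AddCommGroup A] [Module ℂ A] [AddCommGroup B] [Module ℂ B]
    (T : A →ₗ.[ℂ] B) {c : ℂ} {x y : T.domain} (h : (x : A) = c • (y : A)) : T x = c • T y := by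
  rw [← T.map_smul]; exact congrArg T (Subtype.ext h)

/-- The domain of `S S* + T* T`: all `u ∈ dom S* ∩ dom T` with `S* u ∈ dom S` and
`T u ∈ dom T*`. -/
def hodgeDomain (S : E →ₗ.[ℂ] F) (T : F →ₗ.[ℂ] G) : Submodule ℂ F where
  carrier := {u | (∃ h : u ∈ S.adjoint.domain, S.adjoint ⟨u, h⟩ ∈ S.domain) ∧
    ∃ h : u ∈ T.domain, T ⟨u, h⟩ ∈ T.adjoint.domain}
  zero_mem' := by
    refine ⟨⟨zero_mem _, ?_⟩, zero_mem _, ?_⟩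
    · rw [show (⟨0, zero_mem _⟩ : S.adjoint.domain) = 0 from rfl, S.adjoint.map_zero]
      exact zero_mem _
    · rw [show (⟨0, zero_mem _⟩ : T.domain) = 0 from rfl, T.map_zero]
      exact zero_mem _
  add_mem' := by
    rintro u v ⟨⟨h1, h2⟩, h3, h4⟩ ⟨⟨k1, k2⟩, k3, k4⟩
    refine ⟨⟨add_mem h1 k1, ?_⟩, add_mem h3 k3, ?_⟩
    · rw [pmap_add S.adjoint (y := ⟨u, h1⟩) (z := ⟨v, k1⟩) rfl]
      exact add_mem h2 k2
    · rw [pmap_add T (y := ⟨u, h3⟩) (z := ⟨v, k3⟩) rfl]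
      exact add_mem h4 k4
  smul_mem' := by
    rintro c u ⟨⟨h1, h2⟩, h3, h4⟩
    refine ⟨⟨Submodule.smul_mem _ c h1, ?_⟩, Submodule.smul_mem _ c h3, ?_⟩
    · rw [pmap_smul S.adjoint (c := c) (y := ⟨u, h1⟩) rfl]
      exact Submodule.smul_mem _ c h2
    · rw [pmap_smul T (c := c) (y := ⟨u, h3⟩) rfl]
      exact Submodule.smul_mem _ c h4

/-- For unbounded operators `S : E → F` and `T : F → G`, the operator `S S* + T* T` on its natural
domain. -/
def hodgeLaplacian (S : E →ₗ.[ℂ] F) (T : F →ₗ.[ℂ] G) : F →ₗ.[ℂ] F where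
  domain := hodgeDomain S T
  toFun :=
    { toFun := fun u => S ⟨S.adjoint ⟨u.1, u.2.1.1⟩, u.2.1.2⟩ +
        T.adjoint ⟨T ⟨u.1, u.2.2.1⟩, u.2.2.2⟩
      map_add' := fun u v => by
        rw [add_add_add_comm]
        exact congrArg₂ (· + ·) (pmap_add S (pmap_add S.adjoint rfl))
          (pmap_add T.adjoint (pmap_add T rfl))
      map_smul' := fun c u => by
        rw [RingHom.id_apply, smul_add]
        exact congrArg₂ (· + ·) (pmap_smul S (pmap_smul S.adjoint rfl))
          (pmap_smul T.adjoint (pmap_smul T rfl)) }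

/-- A bounded operator `N` is the Neumann operator of the unbounded operator `A` if it is a
two-sided inverse: `N` maps into `dom A`, `A N = id`, and `N A = id` on `dom A`.
There is at most one such `N`. -/
structure IsNeumannOperator (A : F →ₗ.[ℂ] F) (N : F →L[ℂ] F) : Prop where
  right_inv : ∀ f, ∃ h : N f ∈ A.domain, A ⟨N f, h⟩ = f
  left_inv : ∀ u : A.domain, N (A u) = u

end Hodge

/-- The Kohn Laplacian `□_b = ∂̄_b ∂̄_b* + ∂̄_b* ∂̄_b` on `L²_{(0,q)}(Ω)`, where `∂̄_b*` is the `L²`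
adjoint of the maximal `∂̄_b`, with its natural domain (the `∂̄_b`-Neumann boundary conditions).
In degree `0` the first summand is absent. -/
def kohnLaplacian (n : ℕ) : (q : ℕ) → L2Form n q →ₗ.[ℂ] L2Form n q
  | 0 => hodgeLaplacian (0 : L2Form n 0 →ₗ.[ℂ] L2Form n 0) (dbar n 0)
  | q + 1 => hodgeLaplacian (dbar n q) (dbar n (q + 1))

/-- The coefficients of `ξ^J = ∑_{k ∈ J} (-1)^{#{j ∈ J : j < k}} z̄ᵏ dz̄^{J \ k}`. -/
def xi {n q : ℕ} (J : MultiIndex n (q + 1)) (p : Heis n) (I : MultiIndex n q) : ℂ :=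
  ∑ k : {k // k ∈ J.1}, if J.erase k = I then sign k.1 J.1 * conj (p.2 k.1) else 0

/-- The multi-index `{1, …, q + 1}`, the first `q + 1` of the `n` indices. -/
def firstIndices (n q : ℕ) (h : q + 2 ≤ n) : MultiIndex n (q + 1) :=
  ⟨Finset.univ.map (Fin.castLEEmb (show q + 1 ≤ n by lia)), by simp⟩

/-- The coefficients of the `(0,q)`-form `u_h = h(w) (zⁿ)^l s^{-(q+1)} ξ^{{1,…,q+1}}`
(with value `0` where `s = 0`). -/
def uForm (n q : ℕ) (hq : q + 2 ≤ n) (l : ℕ) (h : ℂ → ℂ) (p : Heis n) :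
    EuclideanSpace ℂ (MultiIndex n q) :=
  WithLp.toLp 2 fun I => h (wFun p) * p.2 ⟨n - 1, by lia⟩ ^ l / (sFun p : ℂ) ^ (q + 1) *
    xi (firstIndices n q hq) p I

/-- The functions `h_k(ζ) = √(8k+2) ζ^{4k}`. -/
def hFun (k : ℕ) (ζ : ℂ) : ℂ := (Real.sqrt (8 * k + 2) : ℂ) * ζ ^ (4 * k)

end Heisenberg

end

namespace Heisenberg

variable {n : ℕ}

/-! ### Calculus of `L̄_k` -/

/-! Let X denote contraction with `∑ z̄ᵏ ∂/∂z̄ᵏ` (that is, `intMul` with coefficients `conj (p.2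
k)`) and let `θ = ∂̄_b s = ∑ zᵏ dz̄ᵏ`. Since `L̄_k t = -i zᵏ` and `L̄_k s = zᵏ`, every smooth
function of `(t, s)` has `∂̄_b` proportional to `θ`, while `w = t + is` is CR. The ball is defined
by a function of `(t, s)`, so `X u = 0` implies the boundary condition for `∂̄_b*`. When it holds
everywhere, the derivatives of a cutoff in `(t, s)` drop out of the integration by parts altogether,
and nothing has to be estimated near the boundary, its characteristic points included
(`inner_toForm_eq_of_isWeakDbar`, `toForm_mem_adjoint`).

For the same reason multiplication by `h(w)` commutes with `∂̄_b` (as `w` is CR) and with the formal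
adjoint on `ker X` (as the derivatives of `conj h(w)` are proportional to `zᵏ`). Put `v = (z^N)^l
s^{-m} ξ^J` with `m = #J` and `N ∉ J`. Then `X v = 0` because `ξ^J = X dz̄^J` and `X² = 0`; the
formal adjoint kills `v` (`codiffCoeff_uCoeff`); and `∂̄_b v` is a function times `X(θ ∧ dz̄^J)`,
hence again in `ker X` (`dbarCoeff_uCoeff`). So `h(w) v` lies in the domain of `□_b` and `□_b (h(w)
v) = h(w) □_b v`: the Laplacian does not differentiate `h`. A large `l` only serves to make the
coefficients regular where `s = 0`.

It remains to compare norms. Homogeneity under `(t, z) ↦ (r² t, r z)` evaluates `∫ |w|^m ρ` as an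
explicit multiple of `∫ ρ` (`radialIntegral_eq`). Consequently `‖h_k(w) a‖` is bounded in `k` for
each continuous `a`, and `‖h_k(w) v‖` is bounded below, whereas `h_k(w) → 0` almost everywhere. No
subsequence of `h_k(w) v` can then converge, and a bounded inverse of `□_b` sends the bounded
sequence `□_b (h_k(w) v)` to it, so it is not compact. -/

lemma Lbar_eq_of_hasFDerivAt {k : Fin n} {φ : Heis n → ℂ} {D : Heis n →L[ℝ] ℂ} {p : Heis n}
    (h : HasFDerivAt φ D p) :
    Lbar k φ p = (1 / 2 : ℂ) * (D (0, Pi.single k 1) + Complex.I * D (0, Pi.single k Complex.I)) -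
      Complex.I * p.2 k * D (1, 0) := by
  simp [Lbar, partialZbar, partialT, h.fderiv]

lemma Lbar_const (k : Fin n) (c : ℂ) (p : Heis n) : Lbar k (fun _ => c) p = 0 := by
  simp [Lbar_eq_of_hasFDerivAt (hasFDerivAt_const c p)]

lemma Lbar_add {k : Fin n} {φ ψ : Heis n → ℂ} {p : Heis n} (hφ : DifferentiableAt ℝ φ p)
    (hψ : DifferentiableAt ℝ ψ p) :
    Lbar k (fun p => φ p + ψ p) p = Lbar k φ p + Lbar k ψ p := by
  rw [Lbar_eq_of_hasFDerivAt (hφ.hasFDerivAt.fun_add hψ.hasFDerivAt),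
    Lbar_eq_of_hasFDerivAt hφ.hasFDerivAt, Lbar_eq_of_hasFDerivAt hψ.hasFDerivAt]
  simp only [add_apply]
  ring

lemma Lbar_sum {ι : Type*} {k : Fin n} {s : Finset ι} {φ : ι → Heis n → ℂ} {p : Heis n}
    (hφ : ∀ i ∈ s, DifferentiableAt ℝ (φ i) p) :
    Lbar k (fun p => ∑ i ∈ s, φ i p) p = ∑ i ∈ s, Lbar k (φ i) p := by
  classical
  induction s using Finset.induction_on with
  | empty => simp [Lbar_const]
  | insert i s hi ih =>
    simp only [Finset.sum_insert hi]
    have h1 : ∀ j ∈ s, DifferentiableAt ℝ (φ j) p := fun j hj =>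
      hφ j (Finset.mem_insert_of_mem hj)
    rw [Lbar_add (hφ i (Finset.mem_insert_self _ _)) (DifferentiableAt.fun_sum h1), ih h1]

lemma Lbar_mul {k : Fin n} {φ ψ : Heis n → ℂ} {p : Heis n} (hφ : DifferentiableAt ℝ φ p)
    (hψ : DifferentiableAt ℝ ψ p) :
    Lbar k (fun p => φ p * ψ p) p = φ p * Lbar k ψ p + ψ p * Lbar k φ p := by
  rw [Lbar_eq_of_hasFDerivAt (hφ.hasFDerivAt.fun_mul hψ.hasFDerivAt),
    Lbar_eq_of_hasFDerivAt hφ.hasFDerivAt, Lbar_eq_of_hasFDerivAt hψ.hasFDerivAt]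
  simp only [add_apply, smul_apply, smul_eq_mul]
  ring

lemma Lbar_const_mul {k : Fin n} {φ : Heis n → ℂ} {p : Heis n} (c : ℂ)
    (hφ : DifferentiableAt ℝ φ p) : Lbar k (fun p => c * φ p) p = c * Lbar k φ p := by
  rw [Lbar_mul (differentiableAt_const c) hφ, Lbar_const]; ring

lemma Lbar_pow {k : Fin n} {φ : Heis n → ℂ} {p : Heis n} (m : ℕ) (hφ : DifferentiableAt ℝ φ p) :
    Lbar k (fun p => φ p ^ m) p = m * φ p ^ (m - 1) * Lbar k φ p := by
  rw [Lbar_eq_of_hasFDerivAt (hφ.hasFDerivAt.pow m), Lbar_eq_of_hasFDerivAt hφ.hasFDerivAt]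
  simp only [smul_apply, smul_eq_mul, nsmul_eq_mul]
  ring

lemma Lbar_ofReal_comp {k : Fin n} {g : ℝ → ℝ} {r : Heis n → ℝ} {p : Heis n}
    (hg : DifferentiableAt ℝ g (r p)) (hr : DifferentiableAt ℝ r p) :
    Lbar k (fun p => (g (r p) : ℂ)) p = deriv g (r p) * Lbar k (fun p => (r p : ℂ)) p := by
  have h1 : HasFDerivAt (fun p => (g (r p) : ℂ)) _ p :=
    Complex.ofRealCLM.hasFDerivAt.comp p (hg.hasDerivAt.comp_hasFDerivAt p hr.hasFDerivAt)
  have h2 : HasFDerivAt (fun p => (r p : ℂ)) _ p :=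
    Complex.ofRealCLM.hasFDerivAt.comp p hr.hasFDerivAt
  rw [Lbar_eq_of_hasFDerivAt h1, Lbar_eq_of_hasFDerivAt h2]
  simp only [ContinuousLinearMap.comp_apply, smul_apply, smul_eq_mul,
    Complex.ofRealCLM_apply, Complex.ofReal_mul]
  ring

lemma continuous_Lbar {k : Fin n} {φ : Heis n → ℂ} (hφ : ContDiff ℝ 1 φ) :
    Continuous (Lbar k φ) := by
  have := hφ.continuous_fderiv one_ne_zero
  unfold Lbar partialZbar partialT
  fun_prop

lemma Lbar_eq_zero_of_notMem_tsupport {k : Fin n} {φ : Heis n → ℂ} {p : Heis n}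
    (hp : p ∉ tsupport φ) : Lbar k φ p = 0 := by
  simp [Lbar, partialZbar, partialT, fderiv_of_notMem_tsupport (𝕜 := ℝ) hp]

/-! ### Coordinates, `s` and `w` -/

/-- The coordinate `zᵏ` as a real-linear map. -/
noncomputable def zCLM (k : Fin n) : Heis n →L[ℝ] ℂ :=
  (ContinuousLinearMap.proj k).comp (ContinuousLinearMap.snd ℝ ℝ (Fin n → ℂ))

lemma hasFDerivAt_z (k : Fin n) (p : Heis n) : HasFDerivAt (fun p : Heis n => p.2 k) (zCLM k) p :=
  (zCLM k).hasFDerivAt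

lemma contDiff_z (k : Fin n) {m : WithTop ℕ∞} : ContDiff ℝ m (fun p : Heis n => p.2 k) :=
  (zCLM k).contDiff

lemma contDiff_conj {φ : Heis n → ℂ} {m : WithTop ℕ∞} (h : ContDiff ℝ m φ) :
    ContDiff ℝ m (fun p => conj (φ p)) :=
  Complex.conjCLE.contDiff.comp h

lemma contDiff_ofReal {φ : Heis n → ℝ} {m : WithTop ℕ∞} (h : ContDiff ℝ m φ) :
    ContDiff ℝ m (fun p => (φ p : ℂ)) :=
  Complex.ofRealCLM.contDiff.comp h

lemma differentiableAt_conj {φ : Heis n → ℂ} {p : Heis n} (h : DifferentiableAt ℝ φ p) :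
    DifferentiableAt ℝ (fun p => conj (φ p)) p :=
  Complex.conjCLE.differentiableAt.comp p h

lemma Lbar_z (k j : Fin n) (p : Heis n) : Lbar k (fun p => p.2 j) p = 0 := by
  rw [Lbar_eq_of_hasFDerivAt (hasFDerivAt_z j p)]
  rcases eq_or_ne j k with rfl | h
  · simp [zCLM]
  · simp [zCLM, h]

lemma Lbar_conj_z (k j : Fin n) (p : Heis n) :
    Lbar k (fun p => conj (p.2 j)) p = if k = j then 1 else 0 := by
  have : HasFDerivAt (fun p : Heis n => conj (p.2 j)) _ p :=
    Complex.conjCLE.hasFDerivAt.comp p (hasFDerivAt_z j p)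
  rw [Lbar_eq_of_hasFDerivAt this]
  rcases eq_or_ne j k with rfl | h
  · simp [zCLM]; norm_num
  · simp [zCLM, h, h.symm]

lemma Lbar_t (k : Fin n) (p : Heis n) :
    Lbar k (fun p => (p.1 : ℂ)) p = -(Complex.I * p.2 k) := by
  have : HasFDerivAt (fun p : Heis n => (p.1 : ℂ)) _ p :=
    Complex.ofRealCLM.hasFDerivAt.comp p (ContinuousLinearMap.fst ℝ ℝ (Fin n → ℂ)).hasFDerivAt
  rw [Lbar_eq_of_hasFDerivAt this]
  simp

lemma sFun_eq_sum (p : Heis n) : (sFun p : ℂ) = ∑ k, p.2 k * conj (p.2 k) := by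
  simp [sFun, Complex.mul_conj']

lemma sFun_nonneg (p : Heis n) : 0 ≤ sFun p := Finset.sum_nonneg fun _ _ => by positivity

lemma norm_sq_le_sFun (p : Heis n) (k : Fin n) : ‖p.2 k‖ ^ 2 ≤ sFun p :=
  Finset.single_le_sum (f := fun k => ‖p.2 k‖ ^ 2) (fun k _ => by positivity) (Finset.mem_univ k)

lemma eq_zero_of_sFun_eq_zero {p : Heis n} (h : sFun p = 0) : p.2 = 0 := by
  ext k
  have := norm_sq_le_sFun p k
  rw [h] at this
  simpa using this.antisymm (by positivity)

lemma contDiff_sFun {m : WithTop ℕ∞} : ContDiff ℝ m (sFun (n := n)) := by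
  unfold sFun
  exact ContDiff.sum fun k _ => (contDiff_norm_sq ℝ).comp (contDiff_z k)

lemma contDiff_wFun {m : WithTop ℕ∞} : ContDiff ℝ m (wFun (n := n)) := by
  unfold wFun
  exact (contDiff_ofReal contDiff_fst).add (contDiff_const.mul (contDiff_ofReal contDiff_sFun))

lemma differentiableAt_z (k : Fin n) (p : Heis n) :
    DifferentiableAt ℝ (fun p : Heis n => p.2 k) p := (hasFDerivAt_z k p).differentiableAt

lemma differentiableAt_s (p : Heis n) : DifferentiableAt ℝ (fun p : Heis n => (sFun p : ℂ)) p :=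
  ((contDiff_ofReal (contDiff_sFun (m := 1))).differentiable one_ne_zero) p

lemma differentiableAt_t (p : Heis n) : DifferentiableAt ℝ (fun p : Heis n => (p.1 : ℂ)) p :=
  ((contDiff_ofReal (contDiff_fst (n := 1))).differentiable one_ne_zero) p

lemma Lbar_s (k : Fin n) (p : Heis n) : Lbar k (fun p => (sFun p : ℂ)) p = p.2 k := by
  simp only [sFun_eq_sum]
  rw [Lbar_sum fun j _ =>
    (differentiableAt_z j p).fun_mul (differentiableAt_conj (differentiableAt_z j p))]
  simp only [Lbar_mul (differentiableAt_z _ p) (differentiableAt_conj (differentiableAt_z _ p)),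
    Lbar_conj_z, Lbar_z]
  simp

lemma Lbar_w (k : Fin n) (p : Heis n) : Lbar k wFun p = 0 := by
  have : (wFun : Heis n → ℂ) = fun p => (p.1 : ℂ) + Complex.I * (sFun p : ℂ) := rfl
  rw [this, Lbar_add (differentiableAt_t p) ((differentiableAt_s p).const_mul _),
    Lbar_const_mul _ (differentiableAt_s p), Lbar_t, Lbar_s]
  ring

lemma Lbar_conj_w (k : Fin n) (p : Heis n) :
    Lbar k (fun p => conj (wFun p)) p = -(2 * Complex.I) * p.2 k := by
  have : (fun p : Heis n => conj (wFun p)) = fun p => (p.1 : ℂ) + -Complex.I * (sFun p : ℂ) := by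
    ext p; simp [wFun]
  rw [this, Lbar_add (differentiableAt_t p) ((differentiableAt_s p).const_mul _),
    Lbar_const_mul _ (differentiableAt_s p), Lbar_t, Lbar_s]
  ring

/-! ### The quotients `(z^N)^l / s^m` -/

/-- The function `(z^N)^l / s^m`, with value `0` where `s = 0` (if `m ≠ 0`). -/
noncomputable def zPowDiv (N : Fin n) (l m : ℕ) (p : Heis n) : ℂ :=
  p.2 N ^ l / (sFun p : ℂ) ^ m

/-- The bound `|z^N|² ≤ s` absorbs the denominator. All regularity at `s = 0` comes from this
estimate. -/
lemma norm_zPowDiv_le (N : Fin n) {l m : ℕ} (h : 2 * m ≤ l) (p : Heis n) :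
    ‖zPowDiv N l m p‖ ≤ ‖p.2 N‖ ^ (l - 2 * m) := by
  rw [zPowDiv, norm_div, norm_pow, norm_pow, Complex.norm_real, Real.norm_of_nonneg (sFun_nonneg p)]
  refine div_le_of_le_mul₀ (pow_nonneg (sFun_nonneg p) _) (by positivity) ?_
  calc ‖p.2 N‖ ^ l = ‖p.2 N‖ ^ (l - 2 * m) * (‖p.2 N‖ ^ 2) ^ m := by
        rw [← pow_mul, ← pow_add]; congr 1; lia
    _ ≤ _ := by gcongr; exact norm_sq_le_sFun p N

lemma contDiffAt_zPowDiv (N : Fin n) (l m : ℕ) {p : Heis n} (hp : sFun p ≠ 0)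
    {r : WithTop ℕ∞} : ContDiffAt ℝ r (zPowDiv N l m) p := by
  unfold zPowDiv
  simp only [div_eq_mul_inv]
  refine ((contDiff_z N).contDiffAt.pow l).mul
    (((contDiff_ofReal contDiff_sFun).contDiffAt.pow m).inv ?_)
  simp [hp]

lemma zPowDiv_eq_zero (N : Fin n) {l m : ℕ} (h : 2 * m < l) {p : Heis n} (hp : sFun p = 0) :
    zPowDiv N l m p = 0 := by
  have := norm_zPowDiv_le N h.le p
  rw [eq_zero_of_sFun_eq_zero hp, Pi.zero_apply, norm_zero, zero_pow (by lia)] at this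
  exact norm_le_zero_iff.1 this

lemma continuous_zPowDiv (N : Fin n) {l m : ℕ} (h : 2 * m < l) : Continuous (zPowDiv N l m) := by
  refine continuous_iff_continuousAt.2 fun p => ?_
  by_cases hp : sFun p = 0
  · rw [ContinuousAt, zPowDiv_eq_zero N h hp]
    refine squeeze_zero_norm (fun q => norm_zPowDiv_le N h.le q) ?_
    have hc : Continuous fun q : Heis n => ‖q.2 N‖ ^ (l - 2 * m) := by fun_prop
    have := hc.tendsto p
    rwa [eq_zero_of_sFun_eq_zero hp, Pi.zero_apply, norm_zero, zero_pow (by lia)] at this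
  · exact (contDiffAt_zPowDiv N l m hp (r := 1)).continuousAt

/-- Away from `s = 0` this is the quotient rule. Where `s = 0` the function is of order `l - 2m ≥
2`, so its derivative is zero; the margin `3` is what makes the term with `s^{-(m+1)}` vanish there
as well and be continuous. -/
lemma hasFDerivAt_zPowDiv (N : Fin n) {l m : ℕ} (h : 2 * m + 3 ≤ l) (p : Heis n) :
    HasFDerivAt (zPowDiv N l m)
      ((l * zPowDiv N (l - 1) m p) • zCLM N -
        (m * zPowDiv N l (m + 1) p) • fderiv ℝ (fun p : Heis n => (sFun p : ℂ)) p) p := by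
  by_cases hp : sFun p = 0
  · rw [zPowDiv_eq_zero N (by lia) hp, zPowDiv_eq_zero N (by lia) hp]
    have h0 : ((l * 0 : ℂ) • zCLM N - (m * 0 : ℂ) •
        fderiv ℝ (fun p : Heis n => (sFun p : ℂ)) p) = 0 := by ext <;> simp
    rw [h0]
    refine Asymptotics.IsBigO.hasFDerivAt (n := l - 2 * m) (.of_bound 1 (.of_forall fun q => ?_))
      (by lia)
    rw [one_mul, norm_pow, norm_norm]
    refine (norm_zPowDiv_le N (by lia) q).trans (pow_le_pow_left₀ (norm_nonneg _) ?_ _)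
    have h0 : q.2 N = (q - p).2 N := by simp [eq_zero_of_sFun_eq_zero hp]
    rw [h0]
    exact (norm_le_pi_norm _ N).trans (norm_snd_le (q - p))
  · have hc : (sFun p : ℂ) ≠ 0 := by simpa using hp
    have h1 := ((hasFDerivAt_z N p).pow l).mul ((hasFDerivAt_inv' (𝕜 := ℝ) (pow_ne_zero m hc)).comp p
      ((differentiableAt_s p).hasFDerivAt.pow m))
    have h2 : zPowDiv N l m = (fun p => p.2 N ^ l) * (Inv.inv ∘ fun p => (sFun p : ℂ) ^ m) := by
      ext q; simp [zPowDiv, div_eq_mul_inv]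
    rw [h2]
    refine h1.congr_fderiv (ContinuousLinearMap.ext fun v => ?_)
    simp only [zPowDiv, nsmul_eq_mul, ContinuousLinearMap.comp_apply, add_apply, neg_apply,
      sub_apply, smul_apply, smul_eq_mul, ContinuousLinearMap.mulLeftRight_apply,
      Function.comp_apply]
    rcases m with _ | m
    · simp
    · simp only [Nat.add_sub_cancel]; field_simp; ring

lemma contDiff_zPowDiv (N : Fin n) {l m : ℕ} (h : 2 * m + 3 ≤ l) :
    ContDiff ℝ 1 (zPowDiv N l m) := by
  rw [contDiff_one_iff_hasFDerivAt]
  refine ⟨_, ?_, fun p => hasFDerivAt_zPowDiv N h p⟩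
  have h1 := continuous_zPowDiv N (l := l - 1) (m := m) (by lia)
  have h2 := continuous_zPowDiv N (l := l) (m := m + 1) (by lia)
  have h3 := (contDiff_ofReal (contDiff_sFun (n := n) (m := 1))).continuous_fderiv one_ne_zero
  fun_prop

lemma differentiableAt_zPowDiv (N : Fin n) {l m : ℕ} (h : 2 * m + 3 ≤ l) (p : Heis n) :
    DifferentiableAt ℝ (zPowDiv N l m) p := (hasFDerivAt_zPowDiv N h p).differentiableAt

lemma Lbar_zPowDiv (k N : Fin n) {l m : ℕ} (h : 2 * m + 3 ≤ l) (p : Heis n) :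
    Lbar k (zPowDiv N l m) p = -(m * zPowDiv N l (m + 1) p) * p.2 k := by
  have h1 := Lbar_z k N p
  have h2 := Lbar_s k p
  rw [Lbar_eq_of_hasFDerivAt (hasFDerivAt_z N p)] at h1
  rw [Lbar_eq_of_hasFDerivAt (differentiableAt_s p).hasFDerivAt] at h2
  rw [Lbar_eq_of_hasFDerivAt (hasFDerivAt_zPowDiv N h p)]
  simp only [sub_apply, smul_apply, smul_eq_mul]
  linear_combination (l * zPowDiv N (l - 1) m p) * h1 - (m * zPowDiv N l (m + 1) p) * h2

/-- After conjugation the numerator is a power of `z̄^N`, so it contributes in the single direction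
`k = N`; the denominator contributes a multiple of `zᵏ`. -/
lemma Lbar_conj_zPowDiv (k N : Fin n) {l m : ℕ} (h : 2 * m + 3 ≤ l) (p : Heis n) :
    Lbar k (fun p => conj (zPowDiv N l m p)) p =
      (if k = N then l * conj (zPowDiv N (l - 1) m p) else 0) -
        m * conj (zPowDiv N l (m + 1) p) * p.2 k := by
  have h1 := Lbar_conj_z k N p
  have h2 := Lbar_s k p
  have hs : HasFDerivAt (fun p : Heis n => conj (sFun p : ℂ)) _ p :=
    Complex.conjCLE.hasFDerivAt.comp p (differentiableAt_s p).hasFDerivAt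
  simp only [Complex.conj_ofReal] at hs
  have hz : HasFDerivAt (fun p : Heis n => conj (p.2 N)) _ p :=
    Complex.conjCLE.hasFDerivAt.comp p (hasFDerivAt_z N p)
  have hF : HasFDerivAt (fun p : Heis n => conj (zPowDiv N l m p)) _ p :=
    Complex.conjCLE.hasFDerivAt.comp p (hasFDerivAt_zPowDiv N h p)
  rw [Lbar_eq_of_hasFDerivAt hz] at h1
  rw [Lbar_eq_of_hasFDerivAt hs] at h2
  rw [Lbar_eq_of_hasFDerivAt hF]
  simp only [ContinuousLinearMap.comp_apply, sub_apply,
    smul_apply, smul_eq_mul, ContinuousLinearEquiv.coe_coe,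
    Complex.conjCLE_apply, map_sub, map_mul, Complex.conj_natCast] at h1 h2 ⊢
  have h3 : (if k = N then (l : ℂ) * conj (zPowDiv N (l - 1) m p) else 0) =
    l * conj (zPowDiv N (l - 1) m p) * (if k = N then 1 else 0) := by split_ifs <;> simp
  rw [h3]
  linear_combination (l * conj (zPowDiv N (l - 1) m p)) * h1 -
    (m * conj (zPowDiv N l (m + 1) p)) * h2

/-! ### Exterior and intMul multiplication on coefficient functions -/

lemma sign_mul_self (k : Fin n) (J : Finset (Fin n)) : sign k J * sign k J = 1 := by
  rw [sign, ← mul_pow]; simp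

lemma conj_sign (k : Fin n) (J : Finset (Fin n)) : conj (sign k J) = sign k J := by
  simp [sign]

lemma sign_insert {m : Fin n} {I : Finset (Fin n)} (hm : m ∉ I) (k : Fin n) :
    sign k (insert m I) = (if m < k then -1 else 1) * sign k I := by
  simp only [sign, Finset.filter_insert]
  split_ifs with h
  · rw [Finset.card_insert_of_notMem (by simp [hm]), pow_succ]; ring
  · simp

lemma sign_erase {m : Fin n} {I : Finset (Fin n)} (hm : m ∈ I) (k : Fin n) :
    sign k (I.erase m) = (if m < k then -1 else 1) * sign k I := by
  conv_rhs => rw [← Finset.insert_erase hm, sign_insert (Finset.notMem_erase m I)]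
  split_ifs <;> simp

/-- Interior multiplication by `∂/∂z̄ᵏ` on coefficients. -/
noncomputable def contr (k : Fin n) (F : Finset (Fin n) → ℂ) (I : Finset (Fin n)) : ℂ :=
  if k ∈ I then 0 else sign k I * F (insert k I)

/-- Exterior multiplication by `dz̄ᵏ` on coefficients. -/
noncomputable def wedge (k : Fin n) (F : Finset (Fin n) → ℂ) (K : Finset (Fin n)) : ℂ :=
  if k ∈ K then sign k K * F (K.erase k) else 0

lemma contr_contr (k m : Fin n) (F : Finset (Fin n) → ℂ) (I : Finset (Fin n)) :
    contr k (contr m F) I = -contr m (contr k F) I := by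
  by_cases hk : k ∈ I
  · by_cases hm : m ∈ I <;> simp [contr, hk, hm]
  by_cases hm : m ∈ I
  · simp [contr, hk, hm]
  rcases lt_trichotomy k m with h | rfl | h
  · simp [contr, hk, hm, h.ne, h.ne', sign_insert hk, sign_insert hm, h, h.not_gt,
      Finset.insert_comm k m]
    ring
  · simp [contr, hk]
  · simp [contr, hk, hm, h.ne, h.ne', sign_insert hk, sign_insert hm, h, h.not_gt,
      Finset.insert_comm k m]
    ring

/-- The canonical anticommutation relation; for `k ≠ m` the two signs differ according to which of
the indices is smaller. -/
lemma contr_wedge (k m : Fin n) (F : Finset (Fin n) → ℂ) (I : Finset (Fin n)) :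
    contr k (wedge m F) I + wedge m (contr k F) I = if k = m then F I else 0 := by
  rcases eq_or_ne k m with rfl | hkm
  · by_cases hk : k ∈ I
    · simp [contr, wedge, hk, sign_erase hk, ← mul_assoc, sign_mul_self]
    · simp [contr, wedge, hk, sign_insert hk, ← mul_assoc, sign_mul_self]
  by_cases hk : k ∈ I
  · by_cases hm : m ∈ I <;> simp [contr, wedge, hk, hm, hkm]
  by_cases hm : m ∈ I
  · have h1 : (insert k I).erase m = insert k (I.erase m) := by
      ext x; simp only [Finset.mem_erase, Finset.mem_insert]
      constructor
      · tauto
      · rintro (rfl | h)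
        · exact ⟨hkm, .inl rfl⟩
        · exact ⟨h.1, .inr h.2⟩
    rcases lt_or_gt_of_ne hkm with h | h
    · simp [contr, wedge, hk, hm, hkm, h1, sign_insert hk, sign_erase hm, h, h.not_gt]
      ring
    · simp [contr, wedge, hk, hm, hkm, h1, sign_insert hk, sign_erase hm, h, h.not_gt]
      ring
  · simp [contr, wedge, hk, hm, hkm, hkm.symm]

lemma contr_mul (k : Fin n) (c : ℂ) (F : Finset (Fin n) → ℂ) (I : Finset (Fin n)) :
    contr k (fun K => c * F K) I = c * contr k F I := by
  simp only [contr]; split_ifs <;> ring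

lemma contr_add (k : Fin n) (F G : Finset (Fin n) → ℂ) (I : Finset (Fin n)) :
    contr k (fun K => F K + G K) I = contr k F I + contr k G I := by
  simp only [contr]; split_ifs <;> ring

lemma contr_conj (k : Fin n) (F : Finset (Fin n) → ℂ) (I : Finset (Fin n)) :
    contr k (fun K => conj (F K)) I = conj (contr k F I) := by
  simp only [contr]; split_ifs <;> simp [conj_sign]

lemma contr_sum {ι : Type*} (s : Finset ι) (k : Fin n) (F : ι → Finset (Fin n) → ℂ)
    (I : Finset (Fin n)) :
    contr k (fun K => ∑ i ∈ s, F i K) I = ∑ i ∈ s, contr k (F i) I := by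
  simp only [contr]; split_ifs <;> simp [Finset.mul_sum]

lemma wedge_mul (k : Fin n) (c : ℂ) (F : Finset (Fin n) → ℂ) (I : Finset (Fin n)) :
    wedge k (fun K => c * F K) I = c * wedge k F I := by
  simp only [wedge]; split_ifs <;> ring

lemma wedge_add (k : Fin n) (F G : Finset (Fin n) → ℂ) (I : Finset (Fin n)) :
    wedge k (fun K => F K + G K) I = wedge k F I + wedge k G I := by
  simp only [wedge]; split_ifs <;> ring

lemma wedge_sum {ι : Type*} (s : Finset ι) (k : Fin n) (F : ι → Finset (Fin n) → ℂ)
    (I : Finset (Fin n)) :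
    wedge k (fun K => ∑ i ∈ s, F i K) I = ∑ i ∈ s, wedge k (F i) I := by
  simp only [wedge]; split_ifs <;> simp [Finset.mul_sum]

/-- Interior multiplication by the vector `∑ aₖ ∂/∂z̄ᵏ`. -/
noncomputable def intMul (a : Fin n → ℂ) (F : Finset (Fin n) → ℂ) (I : Finset (Fin n)) : ℂ :=
  ∑ k, a k * contr k F I

/-- Exterior multiplication by the covector `∑ bₖ dz̄ᵏ`. -/
noncomputable def extMul (b : Fin n → ℂ) (F : Finset (Fin n) → ℂ) (K : Finset (Fin n)) : ℂ :=
  ∑ k, b k * wedge k F K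

lemma intMul_intMul (a : Fin n → ℂ) (F : Finset (Fin n) → ℂ) :
    intMul a (intMul a F) = 0 := by
  ext I
  have h1 : intMul a (intMul a F) I = ∑ k, ∑ m, a k * (a m * contr k (contr m F) I) := by
    unfold intMul
    simp only [contr_sum, contr_mul, Finset.mul_sum]
  -- Contractions anticommute, so exchanging the two summation indices turns the double sum into its
  -- negative.
  have h2 : intMul a (intMul a F) I = -intMul a (intMul a F) I := by
    conv_lhs => rw [h1, Finset.sum_comm]
    rw [h1, ← Finset.sum_neg_distrib]
    refine Finset.sum_congr rfl fun k _ => ?_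
    rw [← Finset.sum_neg_distrib]
    refine Finset.sum_congr rfl fun m _ => ?_
    rw [contr_contr m k]; ring
  simpa [self_eq_neg] using h2

lemma intMul_extMul (a b : Fin n → ℂ) (F : Finset (Fin n) → ℂ) (I : Finset (Fin n)) :
    intMul a (extMul b F) I + extMul b (intMul a F) I = (∑ k, a k * b k) * F I := by
  unfold intMul extMul
  simp only [contr_sum, contr_mul, wedge_sum, wedge_mul, Finset.mul_sum]
  rw [Finset.sum_comm (f := fun k m => b k * (a m * wedge k (contr m F) I)),
    ← Finset.sum_add_distrib, Finset.sum_mul]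
  refine Finset.sum_congr rfl fun k _ => ?_
  rw [← Finset.sum_add_distrib]
  have : ∀ m, a k * (b m * contr k (wedge m F) I) + b m * (a k * wedge m (contr k F) I) =
      if k = m then a k * b m * F I else 0 := fun m => by
    have h := contr_wedge k m F I
    have h3 : (if k = m then a k * b m * F I else 0) = a k * b m * (if k = m then F I else 0) := by
      split_ifs <;> simp
    rw [h3, ← h]; ring
  simp [this]

/-- The coefficients of `dz̄^J`. -/
noncomputable def basisForm (J K : Finset (Fin n)) : ℂ := if K = J then 1 else 0

/-- Each index of `J` is removed and put back once. This is the identity behind `∂̄_b ξ^J = #J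
dz̄^J`. -/
lemma sum_wedge_basisForm (J K : Finset (Fin n)) :
    ∑ k, wedge k (contr k (basisForm J)) K = J.card * basisForm J K := by
  have h : ∀ k, wedge k (contr k (basisForm J)) K = if k ∈ K then basisForm J K else 0 := by
    intro k
    unfold wedge contr
    split_ifs with hk h1
    · simp at h1
    · rw [Finset.insert_erase hk, sign_erase hk]
      simp [← mul_assoc, sign_mul_self]
    · rfl
  simp only [h, Finset.sum_ite_mem, Finset.univ_inter, Finset.sum_const, nsmul_eq_mul]
  unfold basisForm
  split_ifs with h
  · rw [h]
  · simp

lemma xi_eq_intMul {q : ℕ} (J : MultiIndex n (q + 1)) (p : Heis n) (I : MultiIndex n q) :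
    xi J p I = intMul (fun k => conj (p.2 k)) (basisForm J.1) I.1 := by
  classical
  have h1 : xi J p I = ∑ k ∈ J.1, if J.1.erase k = I.1 then sign k J.1 * conj (p.2 k) else 0 := by
    refine Eq.trans (Finset.sum_congr rfl fun k _ => ?_) (Finset.sum_coe_sort J.1
      (fun k => if J.1.erase k = I.1 then sign k J.1 * conj (p.2 k) else 0))
    simp [Subtype.ext_iff, MultiIndex.erase]
  rw [h1, intMul]
  refine Finset.sum_subset_zero_on_sdiff (Finset.subset_univ J.1) (fun k hk => ?_) fun k hk => ?_
  · have hk : k ∉ J.1 := (Finset.mem_sdiff.1 hk).2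
    unfold contr basisForm
    split_ifs with h2 h3
    · simp
    · rw [← h3] at hk; simp at hk
    · simp
  · unfold contr basisForm
    by_cases hI : k ∈ I.1
    · rw [if_neg, if_pos hI]
      · simp
      · intro h; rw [← h] at hI; simp at hI
    · rw [if_neg hI]
      by_cases h : J.1.erase k = I.1
      · rw [if_pos h, ← h, Finset.insert_erase hk, sign_erase hk]
        simp; ring
      · rw [if_neg h, if_neg]
        · simp
        · intro h2; exact h (by rw [← h2, Finset.erase_insert hI])

lemma sum_subtype_eq_sum_wedge (K : Finset (Fin n)) (G : Fin n → Finset (Fin n) → ℂ) :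
    ∑ k : {k // k ∈ K}, sign k.1 K * G k.1 (K.erase k.1) = ∑ k, wedge k (G k) K := by
  rw [Finset.sum_coe_sort K (fun k => sign k K * G k (K.erase k))]
  simp only [wedge, Finset.sum_ite_mem, Finset.univ_inter]

/-- Exterior and interior multiplication are transposes of each other: pairs `(K, k)` with `k ∈ K`
correspond to pairs `(I, k)` with `k ∉ I` through `I = K \ k`. -/
lemma sum_multiIndex_erase {q : ℕ} (f : MultiIndex n q → ℂ) (G : Fin n → Finset (Fin n) → ℂ) :
    ∑ K : MultiIndex n (q + 1), ∑ k : {k // k ∈ K.1}, sign k.1 K.1 * (f (K.erase k) * G k.1 K.1) =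
      ∑ I : MultiIndex n q, f I * ∑ k, contr k (G k) I.1 := by
  classical
  have h : ∀ I : MultiIndex n q, f I * ∑ k, contr k (G k) I.1 =
      ∑ k : {k // k ∉ I.1}, f I * (sign k.1 I.1 * G k.1 (insert k.1 I.1)) := by
    intro I
    rw [← Finset.sum_subtype (s := Finset.univ.filter (· ∉ I.1)) (by simp)
      (f := fun k => f I * (sign k I.1 * G k (insert k I.1))), Finset.mul_sum, Finset.sum_filter]
    refine Finset.sum_congr rfl fun k _ => ?_
    unfold contr
    split_ifs <;> simp_all
  simp only [h]
  rw [← Fintype.sum_sigma', ← Fintype.sum_sigma']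
  refine Fintype.sum_bijective
    (fun x : Σ K : MultiIndex n (q + 1), {k // k ∈ K.1} =>
      (⟨x.1.erase x.2, ⟨x.2.1, by simp [MultiIndex.erase]⟩⟩ : Σ I : MultiIndex n q, {k // k ∉ I.1}))
    ?_ _ _ ?_
  · rw [Function.bijective_iff_has_inverse]
    refine ⟨fun y => ⟨⟨insert y.2.1 y.1.1, by rw [Finset.card_insert_of_notMem y.2.2, y.1.2]⟩,
      ⟨y.2.1, by simp⟩⟩, ?_, ?_⟩
    · rintro ⟨⟨K, hK⟩, ⟨k, hk⟩⟩
      have h1 : insert k (K.erase k) = K := Finset.insert_erase hk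
      simp only [MultiIndex.erase]
      exact Sigma.subtype_ext (Subtype.ext h1) rfl
    · rintro ⟨⟨I, hI⟩, ⟨k, hk⟩⟩
      have h1 : (insert k I).erase k = I := Finset.erase_insert hk
      simp only [MultiIndex.erase]
      exact Sigma.subtype_ext (Subtype.ext h1) rfl
  · rintro ⟨K, k⟩
    simp only [MultiIndex.erase, Finset.insert_erase k.2, sign_erase k.2]
    simp; ring

/-! ### The ball -/

lemma isCompact_ball (n : ℕ) : IsCompact (ball n) := by
  refine Metric.isCompact_of_isClosed_isBounded (isClosed_ball n) ?_
  refine (Metric.isBounded_closedBall (x := (0 : Heis n)) (r := 1)).subset fun p hp => ?_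
  rw [mem_ball_iff] at hp
  have ht : |p.1| ≤ 1 := by
    rw [← sq_le_one_iff_abs_le_one]; nlinarith [sq_nonneg (sFun p)]
  have hs1 : sFun p ≤ 1 := by nlinarith [sq_nonneg p.1, sFun_nonneg p]
  rw [mem_closedBall_zero_iff, Prod.norm_def, max_le_iff]
  refine ⟨ht, (pi_norm_le_iff_of_nonneg zero_le_one).2 fun k => ?_⟩
  nlinarith [norm_nonneg (p.2 k), norm_sq_le_sFun p k]

lemma mem_interior_ball {p : Heis n} (hp : p.1 ^ 2 + sFun p ^ 2 < 1) : p ∈ interior (ball n) := by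
  refine mem_interior.2 ⟨{p | p.1 ^ 2 + sFun p ^ 2 < 1}, fun q hq => ?_, ?_, hp⟩
  · exact (mem_ball_iff q).2 (le_of_lt hq)
  · have := continuous_sFun (n := n)
    exact isOpen_lt (by fun_prop) continuous_const

lemma sFun_smul (c : ℝ) (p : Heis n) : sFun (c • p) = c ^ 2 * sFun p := by
  simp [sFun, Finset.mul_sum, mul_pow]

lemma lt_one_of_mem_interior_ball {p : Heis n} (hp : p ∈ interior (ball n)) :
    p.1 ^ 2 + sFun p ^ 2 < 1 := by
  have hc : Continuous fun c : ℝ => c • p := by fun_prop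
  have h1 : ∀ᶠ c : ℝ in 𝓝 1, c • p ∈ ball n := by
    have h2 : ball n ∈ 𝓝 ((1 : ℝ) • p) := by
      rw [one_smul]; exact mem_interior_iff_mem_nhds.1 hp
    exact hc.continuousAt h2
  -- A point interior to the ball may be scaled by some `c > 1` without leaving it, which forces
  -- strict inequality.
  obtain ⟨c, hcb, hc1⟩ :=
    ((h1.filter_mono nhdsWithin_le_nhds).and (self_mem_nhdsWithin (s := Set.Ioi (1 : ℝ)))).exists
  rw [mem_ball_iff, sFun_smul] at hcb
  by_contra! h
  have h3 : (c • p).1 = c * p.1 := rfl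
  rw [h3] at hcb
  have h4 : 1 < c ^ 2 := by nlinarith
  have h5 : c ^ 2 ≤ c ^ 4 := by nlinarith
  have : (c * p.1) ^ 2 + (c ^ 2 * sFun p) ^ 2 = c ^ 2 * p.1 ^ 2 + c ^ 4 * sFun p ^ 2 := by ring
  nlinarith [sq_nonneg (sFun p), sq_nonneg p.1, mul_le_mul_of_nonneg_right h5 (sq_nonneg (sFun p))]

lemma ae_mem_interior_ball (n : ℕ) : ∀ᵐ p ∂(ballMeasure n), p ∈ interior (ball n) := by
  rw [ballMeasure, ae_restrict_iff' (isClosed_ball n).measurableSet]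
  have h0 := (convex_ball n).addHaar_frontier volume
  filter_upwards [measure_eq_zero_iff_ae_notMem.1 h0] with p hp hpb
  by_contra hi
  exact hp ((isClosed_ball n).frontier_eq ▸ ⟨hpb, hi⟩)

/-- The excluded sets are the boundary, null by convexity, and the line `z = 0`, null because there
is at least one complex coordinate. -/
lemma ae_ballMeasure [Nonempty (Fin n)] :
    ∀ᵐ p ∂(ballMeasure n), sFun p ≠ 0 ∧ p.1 ^ 2 + sFun p ^ 2 < 1 := by
  have h0 : volume {p : Heis n | p.2 = 0} = 0 := by
    have : {p : Heis n | p.2 = 0} = Set.univ ×ˢ {0} := by ext; simp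
    rw [this, Measure.volume_eq_prod, Measure.prod_prod, measure_singleton, mul_zero]
  filter_upwards [ae_mem_interior_ball n, ae_restrict_of_ae (measure_eq_zero_iff_ae_notMem.1 h0)]
    with p hp hp0
  exact ⟨fun h => hp0 (eq_zero_of_sFun_eq_zero h), lt_one_of_mem_interior_ball hp⟩

/-! ### Cutoff functions of `(t, s)` -/

/-- A cutoff function depending on `t` and `s` only, which vanishes near `s = 0` and near the
boundary of the ball. -/
noncomputable def cutoff (j : ℕ) (p : Heis n) : ℝ :=
  Real.smoothTransition ((j + 1) * sFun p - 1) *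
    Real.smoothTransition ((j + 1) * (1 - p.1 ^ 2 - sFun p ^ 2) - 1)

lemma contDiff_cutoff (j : ℕ) : ContDiff ℝ ∞ (cutoff (n := n) j) := by
  have h1 := contDiff_sFun (n := n) (m := ∞)
  have h2 : ContDiff ℝ ∞ (fun p : Heis n => p.1) := contDiff_fst
  refine (Real.smoothTransition.contDiff.comp ?_).mul (Real.smoothTransition.contDiff.comp ?_)
  · exact (contDiff_const.mul h1).sub contDiff_const
  · exact (contDiff_const.mul ((contDiff_const.sub (h2.pow 2)).sub (h1.pow 2))).sub contDiff_const

lemma norm_cutoff_le (j : ℕ) (p : Heis n) : ‖(cutoff j p : ℂ)‖ ≤ 1 := by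
  rw [Complex.norm_real, cutoff, norm_mul, Real.norm_of_nonneg (Real.smoothTransition.nonneg _),
    Real.norm_of_nonneg (Real.smoothTransition.nonneg _)]
  exact mul_le_one₀ (Real.smoothTransition.le_one _) (Real.smoothTransition.nonneg _)
    (Real.smoothTransition.le_one _)

lemma tendsto_cutoff {p : Heis n} (hs : sFun p ≠ 0) (hp : p.1 ^ 2 + sFun p ^ 2 < 1) :
    Tendsto (fun j => (cutoff j p : ℂ)) atTop (𝓝 1) := by
  refine tendsto_const_nhds.congr' ?_
  have h1 : ∀ a : ℝ, 0 < a → ∀ᶠ j : ℕ in atTop, 1 ≤ (j + 1) * a - 1 := by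
    intro a ha
    have : Tendsto (fun j : ℕ => ((j : ℝ) + 1) * a) atTop atTop :=
      (tendsto_atTop_add_const_right _ _ tendsto_natCast_atTop_atTop).atTop_mul_const ha
    filter_upwards [this.eventually_ge_atTop 2] with j hj
    linarith
  filter_upwards [h1 _ ((sFun_nonneg p).lt_of_ne' hs), h1 (1 - p.1 ^ 2 - sFun p ^ 2) (by linarith)]
    with j h2 h3
  simp [cutoff, Real.smoothTransition.one_of_one_le h2, Real.smoothTransition.one_of_one_le h3]

lemma cutoff_support (j : ℕ) {p : Heis n} (hp : p ∈ tsupport (cutoff (n := n) j)) :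
    1 ≤ (j + 1) * sFun p ∧ 1 ≤ (j + 1) * (1 - p.1 ^ 2 - sFun p ^ 2) := by
  have hs := continuous_sFun (n := n)
  have h1 : Continuous fun p : Heis n => (j + 1) * sFun p := by fun_prop
  have h2 : Continuous fun p : Heis n => (j + 1) * (1 - p.1 ^ 2 - sFun p ^ 2) := by fun_prop
  have hc : IsClosed {p : Heis n | 1 ≤ (j + 1) * sFun p ∧
      1 ≤ (j + 1) * (1 - p.1 ^ 2 - sFun p ^ 2)} :=
    (isClosed_le continuous_const h1).inter (isClosed_le continuous_const h2)
  refine closure_minimal (fun q hq => ?_) hc hp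
  by_contra h
  apply hq
  rw [Set.mem_ofPred_eq, not_and_or, not_le, not_le] at h
  rcases h with h | h
  · simp [cutoff, Real.smoothTransition.zero_of_nonpos (sub_nonpos.2 h.le)]
  · simp [cutoff, Real.smoothTransition.zero_of_nonpos (sub_nonpos.2 h.le)]

lemma tsupport_cutoff_subset (j : ℕ) : tsupport (cutoff (n := n) j) ⊆ interior (ball n) := by
  intro p hp
  refine mem_interior_ball ?_
  have h := (cutoff_support j hp).2
  by_contra! h2
  nlinarith [(Nat.cast_nonneg j : (0 : ℝ) ≤ j)]

lemma sFun_ne_zero_of_mem_tsupport_cutoff (j : ℕ) {p : Heis n}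
    (hp : p ∈ tsupport (cutoff (n := n) j)) : sFun p ≠ 0 := by
  intro h
  have := (cutoff_support j hp).1
  rw [h] at this
  norm_num at this

/-- Chain rule for a function of `(t, s)`. The point is that one factor `c` serves for all `k`; its
size, which may grow with `j`, is irrelevant. -/
lemma exists_Lbar_cutoff (j : ℕ) (p : Heis n) :
    ∃ c : ℂ, ∀ k, Lbar k (fun p => (cutoff j p : ℂ)) p = c * p.2 k := by
  have hs : DifferentiableAt ℝ (sFun (n := n)) p := (contDiff_sFun (m := 1)).differentiable one_ne_zero p
  have hσ : ∀ x, DifferentiableAt ℝ Real.smoothTransition x := fun x =>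
    ((Real.smoothTransition.contDiff (n := 1)).differentiable one_ne_zero) x
  have h1 : DifferentiableAt ℝ (fun p : Heis n => (j + 1) * sFun p - 1) p := by fun_prop
  have h2 : DifferentiableAt ℝ
      (fun p : Heis n => (j + 1) * (1 - p.1 ^ 2 - sFun p ^ 2) - 1) p := by fun_prop
  have e1 : ∀ k, Lbar k (fun p : Heis n => (((j + 1) * sFun p - 1 : ℝ) : ℂ)) p =
      (j + 1) * p.2 k := by
    intro k
    have : (fun p : Heis n => (((j + 1) * sFun p - 1 : ℝ) : ℂ)) =
        fun p => (j + 1) * (sFun p : ℂ) + (-1) := by ext; push_cast; ring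
    rw [this, Lbar_add ((differentiableAt_s p).const_mul _) (differentiableAt_const _), Lbar_const,
      Lbar_const_mul _ (differentiableAt_s p), Lbar_s, add_zero]
  have e2 : ∀ k, Lbar k
      (fun p : Heis n => (((j + 1) * (1 - p.1 ^ 2 - sFun p ^ 2) - 1 : ℝ) : ℂ)) p =
      (2 * (j + 1) * (Complex.I * p.1 - sFun p)) * p.2 k := by
    intro k
    have : (fun p : Heis n => (((j + 1) * (1 - p.1 ^ 2 - sFun p ^ 2) - 1 : ℝ) : ℂ)) =
        fun p => -(j + 1) * ((p.1 : ℂ) ^ 2 + (sFun p : ℂ) ^ 2) + j := by ext; push_cast; ring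
    have d1 := (differentiableAt_t p).fun_pow 2
    have d2 := (differentiableAt_s p).fun_pow 2
    rw [this, Lbar_add ((d1.fun_add d2).const_mul _) (differentiableAt_const _),
      Lbar_const, Lbar_const_mul _ (d1.fun_add d2), Lbar_add d1 d2,
      Lbar_pow _ (differentiableAt_t p), Lbar_pow _ (differentiableAt_s p), Lbar_t, Lbar_s]
    push_cast; ring
  refine ⟨Real.smoothTransition ((j + 1) * sFun p - 1) *
      (deriv Real.smoothTransition ((j + 1) * (1 - p.1 ^ 2 - sFun p ^ 2) - 1) *
        (2 * (j + 1) * (Complex.I * p.1 - sFun p))) +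
      Real.smoothTransition ((j + 1) * (1 - p.1 ^ 2 - sFun p ^ 2) - 1) *
      (deriv Real.smoothTransition ((j + 1) * sFun p - 1) * (j + 1)), fun k => ?_⟩
  · have : (fun p : Heis n => (cutoff j p : ℂ)) = fun p =>
        (Real.smoothTransition ((j + 1) * sFun p - 1) : ℂ) *
        (Real.smoothTransition ((j + 1) * (1 - p.1 ^ 2 - sFun p ^ 2) - 1) : ℂ) := by
      ext; simp [cutoff]
    have d1 : DifferentiableAt ℝ
        (fun p : Heis n => (Real.smoothTransition ((j + 1) * sFun p - 1) : ℂ)) p :=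
      Complex.ofRealCLM.differentiableAt.comp p ((hσ _).comp p h1)
    have d2 : DifferentiableAt ℝ (fun p : Heis n =>
        (Real.smoothTransition ((j + 1) * (1 - p.1 ^ 2 - sFun p ^ 2) - 1) : ℂ)) p :=
      Complex.ofRealCLM.differentiableAt.comp p ((hσ _).comp p h2)
    rw [this, Lbar_mul d1 d2, Lbar_ofReal_comp (hσ _) h1, Lbar_ofReal_comp (hσ _) h2, e1, e2]
    ring

/-! ### Integration by parts -/

lemma integral_fderiv_apply_eq_zero {ψ : Heis n → ℂ} (hψ : ContDiff ℝ 1 ψ)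
    (hc : HasCompactSupport ψ) (v : Heis n) : ∫ p, fderiv ℝ ψ p v = 0 := by
  have h1 : Integrable (fun p => fderiv ℝ ψ p v) :=
    ((hψ.continuous_fderiv one_ne_zero).clm_apply continuous_const).integrable_of_hasCompactSupport
      (hc.fderiv_apply (𝕜 := ℝ) v)
  have := integral_mul_fderiv_eq_neg_fderiv_mul_of_integrable (μ := (volume : Measure (Heis n)))
    (f := fun _ => (1 : ℂ)) (g := ψ) (v := v) (by simp) (by simpa using h1)
    (by simpa using hψ.continuous.integrable_of_hasCompactSupport hc) (by simp)
    (fun p _ => hψ.differentiable one_ne_zero p)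
  simpa using this

lemma integral_Lbar_eq_zero {ψ : Heis n → ℂ} (hψ : ContDiff ℝ 1 ψ)
    (hc : HasCompactSupport ψ) (k : Fin n) : ∫ p, Lbar k ψ p = 0 := by
  have hint : ∀ {χ : Heis n → ℂ} (_ : ContDiff ℝ 1 χ) (_ : HasCompactSupport χ) (v : Heis n),
      Integrable (fun p => fderiv ℝ χ p v) := fun hχ hc v =>
    ((hχ.continuous_fderiv one_ne_zero).clm_apply continuous_const).integrable_of_hasCompactSupport
      (hc.fderiv_apply (𝕜 := ℝ) v)
  have h1 : ContDiff ℝ 1 (fun p => p.2 k * ψ p) := (contDiff_z k).mul hψ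
  have h2 : HasCompactSupport (fun p => p.2 k * ψ p) := hc.mul_left
  have h3 : ∀ p, fderiv ℝ (fun p => p.2 k * ψ p) p (1, 0) = p.2 k * fderiv ℝ ψ p (1, 0) := by
    intro p
    rw [((hasFDerivAt_z k p).fun_mul (hψ.differentiable one_ne_zero p).hasFDerivAt).fderiv]
    simp [zCLM]
  -- The coefficient `zᵏ` does not depend on `t`, so it can be moved under the `t`-derivative, and
  -- `L̄_k ψ` becomes a combination of derivatives of compactly supported functions.
  have h4 : ∀ p, Lbar k ψ p = (1 / 2 : ℂ) * (fderiv ℝ ψ p (0, Pi.single k 1) +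
      Complex.I * fderiv ℝ ψ p (0, Pi.single k Complex.I)) -
      Complex.I * fderiv ℝ (fun p => p.2 k * ψ p) p (1, 0) := by
    intro p; rw [h3, Lbar, partialZbar, partialT]; ring
  simp only [h4]
  rw [integral_sub (((hint hψ hc _).fun_add ((hint hψ hc _).const_mul _)).const_mul _)
    ((hint h1 h2 _).const_mul _), integral_const_mul, integral_const_mul,
    integral_add (hint hψ hc _) ((hint hψ hc _).const_mul _), integral_const_mul,
    integral_fderiv_apply_eq_zero hψ hc, integral_fderiv_apply_eq_zero hψ hc,
    integral_fderiv_apply_eq_zero h1 h2]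
  simp

lemma integral_ballMeasure_eq {φ : Heis n → ℂ} (h : ∀ p, p ∉ ball n → φ p = 0) :
    ∫ p, φ p ∂(ballMeasure n) = ∫ p, φ p :=
  setIntegral_eq_integral_of_forall_compl_eq_zero h

lemma IsTest.eq_zero {φ : Heis n → ℂ} (hφ : IsTest φ) {p : Heis n} (hp : p ∉ ball n) :
    φ p = 0 :=
  image_eq_zero_of_notMem_tsupport fun h => hp (interior_subset (hφ.supp h))

lemma IsTest.Lbar_eq_zero {φ : Heis n → ℂ} (hφ : IsTest φ) (k : Fin n) {p : Heis n}
    (hp : p ∉ ball n) : Lbar k φ p = 0 :=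
  Lbar_eq_zero_of_notMem_tsupport fun h => hp (interior_subset (hφ.supp h))

lemma integral_mul_Lbar {a φ : Heis n → ℂ} (ha : ContDiff ℝ 1 a) (hφ : IsTest φ) (k : Fin n) :
    ∫ p, a p * Lbar k φ p ∂(ballMeasure n) = -∫ p, Lbar k a p * φ p ∂(ballMeasure n) := by
  have hφ1 : ContDiff ℝ 1 φ := hφ.smooth.of_le (by simp)
  have h1 := integral_Lbar_eq_zero (ha.mul hφ1) hφ.compact.mul_left k
  have h2 : ∀ p, Lbar k (fun p => a p * φ p) p = a p * Lbar k φ p + Lbar k a p * φ p := fun p => by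
    rw [Lbar_mul (ha.differentiable one_ne_zero p) (hφ1.differentiable one_ne_zero p)]; ring
  simp only [h2] at h1
  have hc : HasCompactSupport (Lbar k φ) :=
    HasCompactSupport.intro (isCompact_ball n) fun p hp => hφ.Lbar_eq_zero k hp
  have i1 : Integrable (fun p => a p * Lbar k φ p) :=
    (ha.continuous.mul (continuous_Lbar hφ1)).integrable_of_hasCompactSupport hc.mul_left
  have i2 : Integrable (fun p => Lbar k a p * φ p) :=
    ((continuous_Lbar ha).mul hφ1.continuous).integrable_of_hasCompactSupport hφ.compact.mul_left
  rw [integral_add i1 i2] at h1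
  rw [integral_ballMeasure_eq fun p hp => by rw [hφ.Lbar_eq_zero k hp, mul_zero],
    integral_ballMeasure_eq fun p hp => by rw [hφ.eq_zero hp, mul_zero]]
  exact eq_neg_of_add_eq_zero_left h1

/-! ### Forms with continuous coefficients -/

/-- The `(0,q)`-form with the given coefficients; only multi-indices of length `q` are used. -/
noncomputable def coeffs (q : ℕ) (u : Finset (Fin n) → Heis n → ℂ) (p : Heis n) :
    EuclideanSpace ℂ (MultiIndex n q) :=
  WithLp.toLp 2 fun I => u I.1 p

lemma continuous_coeffs (q : ℕ) {u : Finset (Fin n) → Heis n → ℂ} (hu : ∀ I, Continuous (u I)) :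
    Continuous (coeffs q u) :=
  (PiLp.continuous_toLp 2 _).comp (continuous_pi fun I => hu I.1)

lemma memLp_coeffs (q : ℕ) {u : Finset (Fin n) → Heis n → ℂ} (hu : ∀ I, Continuous (u I)) :
    MemLp (coeffs q u) 2 (ballMeasure n) := by
  have hc := continuous_coeffs q hu
  obtain ⟨C, hC⟩ := (isCompact_ball n).exists_bound_of_continuousOn hc.continuousOn
  exact MemLp.of_bound hc.aestronglyMeasurable C
    (ae_restrict_of_forall_mem (isClosed_ball n).measurableSet hC)

/-- A form with continuous coefficients as an element of `L²`. -/
noncomputable def toForm (q : ℕ) {u : Finset (Fin n) → Heis n → ℂ} (hu : ∀ I, Continuous (u I)) :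
    L2Form n q :=
  (memLp_coeffs q hu).toLp

lemma coeFn_toForm (q : ℕ) {u : Finset (Fin n) → Heis n → ℂ} (hu : ∀ I, Continuous (u I)) :
    toForm q hu =ᵐ[ballMeasure n] coeffs q u :=
  MemLp.coeFn_toLp _

lemma integral_toForm_mul (q : ℕ) {u : Finset (Fin n) → Heis n → ℂ} (hu : ∀ I, Continuous (u I))
    (J : MultiIndex n q) (φ : Heis n → ℂ) :
    ∫ p, toForm q hu p J * φ p ∂(ballMeasure n) = ∫ p, u J.1 p * φ p ∂(ballMeasure n) := by
  refine integral_congr_ae ?_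
  filter_upwards [coeFn_toForm q hu] with p hp
  rw [hp]; rfl

/-! ### The weak `∂̄_b` of a `C¹` form -/

/-- The coefficients of `∂̄_b u`. -/
noncomputable def dbarCoeff (u : Finset (Fin n) → Heis n → ℂ) (K : Finset (Fin n)) (p : Heis n) :
    ℂ :=
  ∑ k, wedge k (fun I => Lbar k (u I) p) K

lemma continuous_dbarCoeff {u : Finset (Fin n) → Heis n → ℂ} (hu : ∀ I, ContDiff ℝ 1 (u I))
    (K : Finset (Fin n)) : Continuous (dbarCoeff u K) := by
  unfold dbarCoeff wedge
  refine continuous_finsetSum _ fun k _ => ?_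
  split_ifs
  · exact continuous_const.mul (continuous_Lbar (hu _))
  · exact continuous_const

lemma isWeakDbar_toForm (q : ℕ) {u : Finset (Fin n) → Heis n → ℂ} (hu : ∀ I, ContDiff ℝ 1 (u I)) :
    IsWeakDbar (toForm q fun I => (hu I).continuous) (toForm (q + 1) (continuous_dbarCoeff hu)) := by
  intro K φ hφ
  have hint : ∀ k I, Integrable (fun p => Lbar k (u I) p * φ p) (ballMeasure n) := fun k I =>
    (((continuous_Lbar (hu I)).mul hφ.smooth.continuous).integrable_of_hasCompactSupport
      hφ.compact.mul_left).integrableOn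
  simp only [integral_toForm_mul, integral_mul_Lbar (hu _) hφ]
  have h1 : ∀ p, dbarCoeff u K.1 p * φ p = ∑ k : {k // k ∈ K.1},
      sign k.1 K.1 * (Lbar k.1 (u (K.1.erase k.1)) p * φ p) := by
    intro p
    rw [dbarCoeff, ← sum_subtype_eq_sum_wedge, Finset.sum_mul]
    exact Finset.sum_congr rfl fun k _ => by ring
  simp only [h1]
  rw [integral_finsetSum _ fun k _ => (hint _ _).const_mul _, ← Finset.sum_neg_distrib]
  refine Finset.sum_congr rfl fun k _ => ?_
  rw [integral_const_mul, mul_neg, neg_neg]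
  rfl

lemma toForm_mem_dbar_graph (q : ℕ) {u : Finset (Fin n) → Heis n → ℂ}
    (hu : ∀ I, ContDiff ℝ 1 (u I)) :
    (toForm q fun I => (hu I).continuous, toForm (q + 1) (continuous_dbarCoeff hu)) ∈
      (dbar n q).graph :=
  (dbar_graph n q _ _).2 (isWeakDbar_toForm q hu)

/-! ### Density of the domain -/

lemma eq_zero_of_integral_test_eq_zero {q : ℕ} {g : L2Form n q}
    (hg : ∀ (J : MultiIndex n q) (φ : Heis n → ℂ), IsTest φ →
      ∫ p, g p J * φ p ∂(ballMeasure n) = 0) : g = 0 := by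
  have hK : ∀ K : MultiIndex n q, ∀ᵐ p ∂(ballMeasure n), g p K = 0 := by
    intro K
    have h1 : MemLp (fun p => g p K) 2 (ballMeasure n) :=
      (EuclideanSpace.proj (𝕜 := ℂ) K : _ →L[ℂ] ℂ).comp_memLp' (Lp.memLp g)
    have h2 := isOpen_interior.ae_eq_zero_of_integral_contDiff_smul_eq_zero (μ := ballMeasure n)
      (U := interior (ball n)) (f := fun p => g p K)
      ((h1.integrable one_le_two).locallyIntegrable.locallyIntegrableOn _)
      (fun φ h1 h2 h3 => by
        have hsupp : tsupport (fun p => (φ p : ℂ)) ⊆ tsupport φ :=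
          closure_mono fun p hp h => hp (by simp [h])
        have := hg K (fun p => (φ p : ℂ))
          ⟨Complex.ofRealCLM.contDiff.comp h1, h2.comp_left (g := Complex.ofReal) rfl,
            hsupp.trans h3⟩
        simpa [Complex.real_smul, mul_comm] using this)
    filter_upwards [h2, ae_mem_interior_ball n] with p hp hp' using hp hp'
  rw [Lp.eq_zero_iff_ae_eq_zero]
  filter_upwards [ae_all_iff.2 hK] with p hp
  ext K
  simpa using hp K

/-- Needed for the adjoint to be determined by its defining identity. Test forms belong to the
domain, and a form orthogonal to all of them is zero. -/
lemma dense_dbar_domain (n q : ℕ) : Dense ((dbar n q).domain : Set (L2Form n q)) := by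
  classical
  rw [Submodule.dense_iff_topologicalClosure_eq_top, Submodule.topologicalClosure_eq_top_iff,
    Submodule.eq_bot_iff]
  intro f hf
  refine eq_zero_of_integral_test_eq_zero fun J φ hφ => ?_
  have hφ1 : ContDiff ℝ 1 φ := hφ.smooth.of_le (by simp)
  -- The inner product is conjugate-linear in its first slot, so `conj φ` makes it the plain
  -- integral against `φ`.
  let u : Finset (Fin n) → Heis n → ℂ := fun I p => if I = J.1 then conj (φ p) else 0
  have hu : ∀ I, ContDiff ℝ 1 (u I) := by
    intro I
    by_cases h : I = J.1
    · simpa [u, h] using contDiff_conj hφ1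
    · simpa [u, h] using contDiff_const
  have hd : toForm q (fun I => (hu I).continuous) ∈ (dbar n q).domain :=
    LinearPMap.mem_domain_of_mem_graph (toForm_mem_dbar_graph q hu)
  have h := (Submodule.mem_orthogonal _ _).1 hf _ hd
  rw [L2.inner_def] at h
  rw [← h]
  refine integral_congr_ae ?_
  filter_upwards [coeFn_toForm q (fun I => (hu I).continuous)] with p hp
  rw [hp, PiLp.inner_apply, Finset.sum_eq_single J]
  · simp [coeffs, u]
  · intro I _ hI
    have : I.1 ≠ J.1 := fun h => hI (Subtype.ext h)
    simp [coeffs, u, this]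
  · simp

/-! ### The adjoint on forms annihilated by the Euler contraction -/

/-- The coefficients of the formal adjoint of `∂̄_b` applied to `u`. -/
noncomputable def codiffCoeff (u : Finset (Fin n) → Heis n → ℂ) (I : Finset (Fin n))
    (p : Heis n) : ℂ :=
  -∑ k, contr k (fun K => conj (Lbar k (fun p => conj (u K p)) p)) I

lemma continuous_codiffCoeff {u : Finset (Fin n) → Heis n → ℂ} (hu : ∀ I, ContDiff ℝ 1 (u I))
    (I : Finset (Fin n)) : Continuous (codiffCoeff u I) := by
  unfold codiffCoeff contr
  refine (continuous_finsetSum _ fun k _ => ?_).neg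
  split_ifs
  · exact continuous_const
  · exact continuous_const.mul
      (Complex.continuous_conj.comp (continuous_Lbar (contDiff_conj (hu _))))

/-- The cutoff vanishes near `s = 0`, the only place where the coefficients may fail to be smooth.
-/
lemma isTest_conj_mul_cutoff {v : Heis n → ℂ} (hv : ∀ p, sFun p ≠ 0 → ContDiffAt ℝ ∞ v p) (j : ℕ) :
    IsTest (fun p => conj (v p) * (cutoff j p : ℂ)) := by
  have hsub : tsupport (fun p => conj (v p) * (cutoff j p : ℂ)) ⊆ tsupport (cutoff (n := n) j) :=
    closure_mono fun p hp h => hp (by simp [h])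
  refine ⟨contDiff_iff_contDiffAt.2 fun p => ?_, ?_,
    hsub.trans (tsupport_cutoff_subset j)⟩
  · by_cases hs : sFun p = 0
    · have : (fun p => conj (v p) * (cutoff j p : ℂ)) =ᶠ[𝓝 p] 0 :=
        notMem_tsupport_iff_eventuallyEq.1 fun h =>
          sFun_ne_zero_of_mem_tsupport_cutoff j (hsub h) hs
      exact contDiffAt_const.congr_of_eventuallyEq this
    · exact (Complex.conjCLE.contDiff.contDiffAt.comp p (hv p hs)).mul
        (contDiff_ofReal (contDiff_cutoff j)).contDiffAt
  · exact HasCompactSupport.intro (isCompact_ball n) fun p hp =>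
      image_eq_zero_of_notMem_tsupport (f := fun p => conj (v p) * (cutoff j p : ℂ)) fun h =>
        hp (interior_subset (tsupport_cutoff_subset j (hsub h)))

lemma inner_toForm (q : ℕ) {u : Finset (Fin n) → Heis n → ℂ} (hu : ∀ I, Continuous (u I))
    (f : L2Form n q) :
    Integrable (fun p => ∑ I : MultiIndex n q, f p I * conj (u I.1 p)) (ballMeasure n) ∧
      inner ℂ (toForm q hu) f =
        ∫ p, ∑ I : MultiIndex n q, f p I * conj (u I.1 p) ∂(ballMeasure n) := by
  have h : (fun p => inner ℂ (toForm q hu p) (f p)) =ᵐ[ballMeasure n]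
      fun p => ∑ I : MultiIndex n q, f p I * conj (u I.1 p) := by
    filter_upwards [coeFn_toForm q hu] with p hp
    rw [hp, PiLp.inner_apply]
    rfl
  exact ⟨(L2.integrable_inner (𝕜 := ℂ) (toForm q hu) f).congr h,
    (L2.inner_def (𝕜 := ℂ) _ _).trans (integral_congr_ae h)⟩

lemma tendsto_integral_cutoff [Nonempty (Fin n)] {F : Heis n → ℂ}
    (hF : Integrable F (ballMeasure n)) :
    Tendsto (fun j => ∫ p, (cutoff j p : ℂ) * F p ∂(ballMeasure n)) atTop
      (𝓝 (∫ p, F p ∂(ballMeasure n))) := by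
  refine tendsto_integral_of_dominated_convergence (fun p => ‖F p‖) (fun j => ?_) hF.norm
    (fun j => .of_forall fun p => ?_) ?_
  · exact (contDiff_ofReal (contDiff_cutoff j)).continuous.aestronglyMeasurable.mul
      hF.aestronglyMeasurable
  · rw [norm_mul]
    exact mul_le_of_le_one_left (norm_nonneg _) (norm_cutoff_le j p)
  · filter_upwards [ae_ballMeasure (n := n)] with p hp
    simpa using (tendsto_cutoff hp.1 hp.2).mul_const (F p)

/-- The derivative of the cutoff enters as `c ∑ zᵏ` times contractions of `conj u`, which is `c`
times the conjugate of the Euler contraction of `u` and therefore zero. No commutator term survives.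
-/
lemma sum_contr_Lbar_conj_mul_cutoff {u : Finset (Fin n) → Heis n → ℂ}
    (hu : ∀ I, ContDiff ℝ 1 (u I)) (hX : ∀ p, intMul (fun k => conj (p.2 k)) (fun K => u K p) = 0)
    (j : ℕ) (p : Heis n) (I : Finset (Fin n)) :
    ∑ k, contr k (fun K => Lbar k (fun p => conj (u K p) * (cutoff j p : ℂ)) p) I =
      -((cutoff j p : ℂ) * conj (codiffCoeff u I p)) := by
  obtain ⟨c, hc⟩ := exists_Lbar_cutoff j p
  have h1 : ∀ k K, Lbar k (fun p => conj (u K p) * (cutoff j p : ℂ)) p =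
      (cutoff j p : ℂ) * Lbar k (fun p => conj (u K p)) p + c * (p.2 k * conj (u K p)) := by
    intro k K
    have d1 : DifferentiableAt ℝ (fun p => conj (u K p)) p :=
      differentiableAt_conj ((hu K).differentiable one_ne_zero p)
    have d2 : DifferentiableAt ℝ (fun p => (cutoff j p : ℂ)) p :=
      (contDiff_ofReal (contDiff_cutoff j)).differentiable (by simp) p
    rw [Lbar_mul d1 d2, hc]; ring
  have h2 : ∑ k, p.2 k * contr k (fun K => conj (u K p)) I = 0 := by
    have := congrArg conj (congrFun (hX p) I)
    simpa [intMul, contr_conj] using this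
  simp only [h1, contr_add, contr_mul, Finset.sum_add_distrib, ← Finset.mul_sum, h2, mul_zero,
    add_zero]
  simp only [codiffCoeff, map_neg, map_sum, ← contr_conj, Complex.conj_conj, mul_neg, neg_neg]

lemma IsWeakDbar.sum_integral {q : ℕ} {f : L2Form n q} {f' : L2Form n (q + 1)}
    (hf : IsWeakDbar f f') {φ : Finset (Fin n) → Heis n → ℂ} (hφ : ∀ K, IsTest (φ K)) :
    ∫ p, ∑ K : MultiIndex n (q + 1), f' p K * φ K.1 p ∂(ballMeasure n) =
      ∫ p, -∑ I : MultiIndex n q, f p I * ∑ k, contr k (fun K => Lbar k (φ K) p) I.1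
        ∂(ballMeasure n) := by
  have h1 : ∀ p, ∑ I : MultiIndex n q, f p I * ∑ k, contr k (fun K => Lbar k (φ K) p) I.1 =
      ∑ K : MultiIndex n (q + 1), ∑ k : {k // k ∈ K.1},
        sign k.1 K.1 * (f p (K.erase k) * Lbar k.1 (φ K.1) p) := fun p =>
    (sum_multiIndex_erase (fun I => f p I) (fun k K => Lbar k (φ K) p)).symm
  have h2 : ∀ (K : MultiIndex n (q + 1)) (k : {k // k ∈ K.1}), Integrable
      (fun p => sign k.1 K.1 * (f p (K.erase k) * Lbar k.1 (φ K.1) p)) (ballMeasure n) :=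
    fun K k => ((hφ K.1).integrable_mul_Lbar f _ _).const_mul _
  simp only [h1]
  rw [integral_neg, integral_finsetSum _ fun K _ => integrable_finsetSum _ fun k _ => h2 K k,
    integral_finsetSum _ fun K _ => (hφ K.1).integrable_mul f' K, ← Finset.sum_neg_distrib]
  refine Finset.sum_congr rfl fun K _ => ?_
  rw [hf K _ (hφ K.1), integral_finsetSum _ fun k _ => h2 K k]
  simp only [integral_const_mul]

/-- The weak equation is tested with `conj u` times the cutoff; both sides then carry the cutoff as
a mere factor, and dominated convergence removes it. -/
lemma inner_toForm_eq_of_isWeakDbar [Nonempty (Fin n)] {q : ℕ} {u : Finset (Fin n) → Heis n → ℂ}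
    (hu : ∀ I, ContDiff ℝ 1 (u I)) (hu' : ∀ I p, sFun p ≠ 0 → ContDiffAt ℝ ∞ (u I) p)
    (hX : ∀ p, intMul (fun k => conj (p.2 k)) (fun K => u K p) = 0)
    {f : L2Form n q} {f' : L2Form n (q + 1)} (hf : IsWeakDbar f f') :
    inner ℂ (toForm (q + 1) fun I => (hu I).continuous) f' =
      inner ℂ (toForm q (continuous_codiffCoeff hu)) f := by
  obtain ⟨i1, e1⟩ := inner_toForm (q + 1) (fun I => (hu I).continuous) f'
  obtain ⟨i2, e2⟩ := inner_toForm q (continuous_codiffCoeff hu) f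
  rw [e1, e2]
  have h : ∀ j, ∫ p, (cutoff j p : ℂ) * ∑ I : MultiIndex n q, f p I * conj (codiffCoeff u I.1 p)
      ∂(ballMeasure n) = ∫ p, (cutoff j p : ℂ) *
        ∑ K : MultiIndex n (q + 1), f' p K * conj (u K.1 p) ∂(ballMeasure n) := by
    intro j
    have h0 := hf.sum_integral fun K => isTest_conj_mul_cutoff (hu' K) j
    simp only [sum_contr_Lbar_conj_mul_cutoff hu hX] at h0
    refine Eq.trans ?_ (h0.symm.trans ?_)
    · congr 1 with p
      rw [Finset.mul_sum, ← Finset.sum_neg_distrib]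
      exact Finset.sum_congr rfl fun K _ => by ring
    · congr 1 with p
      rw [Finset.mul_sum]
      exact Finset.sum_congr rfl fun K _ => by ring
  exact tendsto_nhds_unique (tendsto_integral_cutoff i1)
    ((tendsto_integral_cutoff i2).congr h)

lemma toForm_mem_adjoint [Nonempty (Fin n)] (q : ℕ) {u : Finset (Fin n) → Heis n → ℂ}
    (hu : ∀ I, ContDiff ℝ 1 (u I)) (hu' : ∀ I p, sFun p ≠ 0 → ContDiffAt ℝ ∞ (u I) p)
    (hX : ∀ p, intMul (fun k => conj (p.2 k)) (fun K => u K p) = 0) :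
    ∃ h : toForm (q + 1) (fun I => (hu I).continuous) ∈ (dbar n q).adjoint.domain,
      (dbar n q).adjoint ⟨_, h⟩ = toForm q (continuous_codiffCoeff hu) := by
  have key : ∀ x : (dbar n q).domain, inner ℂ (toForm q (continuous_codiffCoeff hu)) (x : L2Form n q)
      = inner ℂ (toForm (q + 1) fun I => (hu I).continuous) (dbar n q x) := fun x =>
    (inner_toForm_eq_of_isWeakDbar hu hu' hX
      ((dbar_graph n q _ _).1 ((dbar n q).mem_graph x))).symm
  have h := LinearPMap.mem_adjoint_domain_of_exists (T := dbar n q) _ ⟨_, key⟩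
  exact ⟨h, LinearPMap.adjoint_apply_eq (dense_dbar_domain n q) ⟨_, h⟩ key⟩

/-! ### Dilations -/

/-- The dilation `(t, z) ↦ (r² t, r z)`. -/
noncomputable def dilation (r : ℝ) (p : Heis n) : Heis n := (r ^ 2 * p.1, r • p.2)

lemma sFun_dilation (r : ℝ) (p : Heis n) : sFun (dilation r p) = r ^ 2 * sFun p := by
  simp [sFun, dilation, Finset.mul_sum, mul_pow]

lemma wFun_dilation (r : ℝ) (p : Heis n) : wFun (dilation r p) = (r ^ 2 : ℝ) * wFun p := by
  rw [wFun, sFun_dilation, wFun]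
  simp only [dilation]
  push_cast; ring

lemma norm_wFun_dilation (r : ℝ) (p : Heis n) : ‖wFun (dilation r p)‖ = r ^ 2 * ‖wFun p‖ := by
  rw [wFun_dilation, norm_mul, Complex.norm_real, Real.norm_of_nonneg (sq_nonneg r)]

/-- The Jacobian is `r²` from `t` times `r^{2n}` from the `2n` real coordinates of `z`. -/
lemma integral_comp_dilation {r : ℝ} (hr : 0 < r) (g : Heis n → ℝ) :
    r ^ (2 * n + 2) * ∫ p, g (dilation r p) = ∫ p, g p := by
  have hr2 : r ^ 2 ≠ 0 := by positivity
  let e : Heis n ≃ₜ Heis n := (Homeomorph.smulOfNeZero (r ^ 2) hr2).prodCongr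
    (Homeomorph.smulOfNeZero r hr.ne')
  have he : ∀ p, e p = dilation r p := fun p => rfl
  have hm : Measure.map e (volume : Measure (Heis n)) =
      ENNReal.ofReal ((r ^ (2 * n + 2))⁻¹) • volume := by
    have h1 : (⇑e : Heis n → Heis n) = Prod.map (r ^ 2 • ·) (r • ·) := rfl
    rw [h1, Measure.volume_eq_prod, ← Measure.map_prod_map _ _ (measurable_const_smul _)
      (measurable_const_smul _), Measure.map_addHaar_smul _ hr2, Measure.map_addHaar_smul _ hr.ne',
      Measure.prod_smul_left, Measure.prod_smul_right, smul_smul,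
      ← ENNReal.ofReal_mul (abs_nonneg _)]
    congr 2
    rw [abs_of_pos (by positivity), abs_of_pos (by positivity)]
    have hd : Module.finrank ℝ (Fin n → ℂ) = 2 * n := by
      rw [Module.finrank_pi_fintype]; simp [mul_comm]
    rw [hd, Module.finrank_self]
    field_simp
    ring
  have h2 : ∫ p, g (dilation r p) = ∫ p, g p ∂(Measure.map e volume) := by
    rw [e.isClosedEmbedding.measurableEmbedding.integral_map]
    rfl
  rw [h2, hm, integral_smul_measure, ENNReal.toReal_ofReal (by positivity), smul_eq_mul,
    mul_inv_cancel_left₀ (by positivity)]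

lemma continuous_wFun : Continuous (wFun (n := n)) := (contDiff_wFun (m := 0)).continuous

/-- The integral of `|w|^m ρ` over the ball. -/
noncomputable def radialIntegral (ρ : Heis n → ℝ) (m : ℕ) : ℝ :=
  ∫ p, ‖wFun p‖ ^ m * ρ p ∂(ballMeasure n)

section

variable {ρ : Heis n → ℝ} {d : ℕ}

/-- The set `|w| ≤ r²` is the unit ball dilated by `r`. The exponent collects `2m` from `|w|^m`, `d`
from `ρ` and `2n + 2` from the volume. -/
lemma setIntegral_small_ball (hd : ∀ r p, 0 < r → ρ (dilation r p) = r ^ d * ρ p) (m : ℕ) {r : ℝ}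
    (hr : 0 < r) :
    ∫ p in {p | ‖wFun p‖ ≤ r ^ 2}, ‖wFun p‖ ^ m * ρ p =
      r ^ (2 * m + (d + (2 * n + 2))) * radialIntegral ρ m := by
  have hms : MeasurableSet {p : Heis n | ‖wFun p‖ ≤ r ^ 2} :=
    (isClosed_le continuous_wFun.norm continuous_const).measurableSet
  rw [← integral_indicator hms, ← integral_comp_dilation hr, radialIntegral, ballMeasure,
    ← integral_indicator (isClosed_ball n).measurableSet]
  have h1 : ∀ p : Heis n, Set.indicator {p | ‖wFun p‖ ≤ r ^ 2} (fun p => ‖wFun p‖ ^ m * ρ p)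
      (dilation r p) =
      r ^ (2 * m + d) * (ball n).indicator (fun p => ‖wFun p‖ ^ m * ρ p) p := by
    intro p
    have h2 : dilation r p ∈ {p : Heis n | ‖wFun p‖ ≤ r ^ 2} ↔ p ∈ ball n := by
      rw [Set.mem_ofPred_eq, norm_wFun_dilation, mul_le_iff_le_one_right (by positivity)]
      rfl
    by_cases hp : p ∈ ball n
    · rw [Set.indicator_of_mem hp, Set.indicator_of_mem (h2.2 hp), norm_wFun_dilation, hd r p hr]
      ring
    · rw [Set.indicator_of_notMem hp, Set.indicator_of_notMem (fun h => hp (h2.1 h)), mul_zero]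
  simp only [h1]
  rw [integral_const_mul]
  ring

lemma integrableOn_ball (hρ : Continuous ρ) (m : ℕ) :
    IntegrableOn (fun p => ‖wFun p‖ ^ m * ρ p) (ball n) :=
  ((continuous_wFun.norm.pow m).mul hρ).continuousOn.integrableOn_compact (isCompact_ball n)

lemma setIntegral_shell (hρ : Continuous ρ) (hd : ∀ r p, 0 < r → ρ (dilation r p) = r ^ d * ρ p)
    (m : ℕ) {r : ℝ} (hr : 0 < r) (hr1 : r < 1) :
    ∫ p in ball n \ {p | ‖wFun p‖ ≤ r ^ 2}, ‖wFun p‖ ^ m * ρ p =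
      (1 - r ^ (2 * m + (d + (2 * n + 2)))) * radialIntegral ρ m := by
  have hms : MeasurableSet {p : Heis n | ‖wFun p‖ ≤ r ^ 2} :=
    (isClosed_le continuous_wFun.norm continuous_const).measurableSet
  have hsub : {p : Heis n | ‖wFun p‖ ≤ r ^ 2} ⊆ ball n := fun p hp =>
    le_trans hp (pow_le_one₀ hr.le hr1.le)
  rw [setIntegral_sdiff hms (integrableOn_ball hρ m) hsub, setIntegral_small_ball hd m hr, sub_mul,
    one_mul]
  rfl

/-- On the shell `r² < |w| ≤ 1` the weight `|w|^m` lies between `r^{2m}` and `1`. As `r → 1` the two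
bounds merge, which replaces differentiation in the radial variable. -/
lemma shell_bounds (hρ : Continuous ρ) (h0 : ∀ p, 0 ≤ ρ p)
    (hd : ∀ r p, 0 < r → ρ (dilation r p) = r ^ d * ρ p) (m : ℕ) {r : ℝ}
    (hr : 0 < r) (hr1 : r < 1) :
    r ^ (2 * m) * ((1 - r ^ (d + (2 * n + 2))) * radialIntegral ρ 0) ≤
        (1 - r ^ (2 * m + (d + (2 * n + 2)))) * radialIntegral ρ m ∧
      (1 - r ^ (2 * m + (d + (2 * n + 2)))) * radialIntegral ρ m ≤
        (1 - r ^ (d + (2 * n + 2))) * radialIntegral ρ 0 := by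
  have e0 := setIntegral_shell hρ hd 0 hr hr1
  rw [mul_zero, zero_add] at e0
  rw [← setIntegral_shell hρ hd m hr hr1, ← e0]
  have hms : MeasurableSet (ball n \ {p : Heis n | ‖wFun p‖ ≤ r ^ 2}) :=
    (isClosed_ball n).measurableSet.diff
      (isClosed_le continuous_wFun.norm continuous_const).measurableSet
  have hi : ∀ m, IntegrableOn (fun p => ‖wFun p‖ ^ m * ρ p)
      (ball n \ {p : Heis n | ‖wFun p‖ ≤ r ^ 2}) := fun m =>
    (integrableOn_ball hρ m).mono_set Set.sdiff_subset
  constructor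
  · rw [← integral_const_mul]
    refine setIntegral_mono_on ((hi 0).const_mul _) (hi m) hms fun p hp => ?_
    have h1 : r ^ 2 ≤ ‖wFun p‖ := (not_le.1 hp.2).le
    rw [pow_zero, one_mul, pow_mul]
    exact mul_le_mul_of_nonneg_right (pow_le_pow_left₀ (by positivity) h1 m) (h0 p)
  · refine setIntegral_mono_on (hi m) (hi 0) hms fun p hp => ?_
    rw [pow_zero]
    exact mul_le_mul_of_nonneg_right (pow_le_one₀ (norm_nonneg _) hp.1) (h0 p)

/-- Integration in homogeneous polar coordinates. -/
lemma radialIntegral_eq (hρ : Continuous ρ) (h0 : ∀ p, 0 ≤ ρ p)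
    (hd : ∀ r p, 0 < r → ρ (dilation r p) = r ^ d * ρ p) (m : ℕ) :
    (2 * m + (d + (2 * n + 2)) : ℝ) * radialIntegral ρ m =
      (d + (2 * n + 2)) * radialIntegral ρ 0 := by
  have hlim : ∀ a : ℕ, Tendsto (fun r : ℝ => ∑ i ∈ Finset.range a, r ^ i) (𝓝[<] 1) (𝓝 a) := by
    intro a
    have hc : Continuous fun r : ℝ => ∑ i ∈ Finset.range a, r ^ i := by fun_prop
    have := (hc.tendsto 1).mono_left (nhdsWithin_le_nhds (s := Set.Iio 1))
    simpa using this
  have hpow : Tendsto (fun r : ℝ => r ^ (2 * m)) (𝓝[<] 1) (𝓝 1) := by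
    have hc : Continuous fun r : ℝ => r ^ (2 * m) := by fun_prop
    have := (hc.tendsto 1).mono_left (nhdsWithin_le_nhds (s := Set.Iio 1))
    simpa using this
  have hev : ∀ᶠ r : ℝ in 𝓝[<] 1, 0 < r ∧ r < 1 := Ioo_mem_nhdsLT zero_lt_one
  have hA := (hlim (2 * m + (d + (2 * n + 2)))).mul_const (radialIntegral ρ m)
  have hB := (hlim (d + (2 * n + 2))).mul_const (radialIntegral ρ 0)
  have key : ∀ r : ℝ, 0 < r → r < 1 → _ := fun r hr hr1 => shell_bounds hρ h0 hd m hr hr1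
  -- Writing `1 - r^a` as a geometric sum times `1 - r` lets the common factor be cancelled; the sum
  -- tends to `a` as `r → 1`.
  simp only [← geom_sum_mul_neg] at key
  have e1 := le_of_tendsto_of_tendsto hA hB (by
    filter_upwards [hev] with r hr
    have h1 := (key r hr.1 hr.2).2
    have : 0 < 1 - r := by linarith [hr.2]
    refine le_of_mul_le_mul_right ?_ this
    linarith)
  have e2 := le_of_tendsto_of_tendsto (hpow.mul hB) hA (by
    filter_upwards [hev] with r hr
    have h1 := (key r hr.1 hr.2).1
    have : 0 < 1 - r := by linarith [hr.2]
    refine le_of_mul_le_mul_right ?_ this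
    linarith)
  rw [one_mul] at e2
  push_cast at e1 e2
  exact le_antisymm e1 e2

lemma radialIntegral_zero_nonneg (h0 : ∀ p, 0 ≤ ρ p) : 0 ≤ radialIntegral ρ 0 :=
  integral_nonneg fun p => mul_nonneg (by positivity) (h0 p)

/-- With `E = d + 2n + 2`, the middle quantity is `(8k + 2) E / (16k + E)` times `radialIntegral ρ
0`. The factor lies between `1` and `E` because `E ≥ 2`. -/
lemma radialIntegral_bounds (hρ : Continuous ρ) (h0 : ∀ p, 0 ≤ ρ p)
    (hd : ∀ r p, 0 < r → ρ (dilation r p) = r ^ d * ρ p) (k : ℕ) :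
    radialIntegral ρ 0 ≤ (8 * k + 2) * radialIntegral ρ (8 * k) ∧
      (8 * k + 2) * radialIntegral ρ (8 * k) ≤ (d + (2 * n + 2)) * radialIntegral ρ 0 := by
  have h1 := radialIntegral_eq hρ h0 hd (8 * k)
  have h2 := radialIntegral_zero_nonneg h0
  push_cast at h1
  set E : ℝ := d + (2 * n + 2) with hE
  have hE2 : 2 ≤ E := by
    have : (0 : ℝ) ≤ d := by positivity
    have : (0 : ℝ) ≤ n := by positivity
    linarith
  have hk : (0 : ℝ) ≤ k := by positivity
  have h3 : radialIntegral ρ (8 * k) = E * radialIntegral ρ 0 / (2 * (8 * k) + E) := by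
    rw [eq_div_iff (by positivity), mul_comm, h1]
  rw [h3]
  constructor
  · rw [mul_div_assoc', le_div_iff₀ (by positivity)]
    have : (2 * (8 * k) + E) ≤ (8 * k + 2) * E := by nlinarith
    nlinarith
  · rw [mul_div_assoc', div_le_iff₀ (by positivity)]
    have : 0 ≤ E * radialIntegral ρ 0 := by positivity
    nlinarith

end

/-! ### Norms of forms -/

lemma norm_sq_toForm (q : ℕ) {u : Finset (Fin n) → Heis n → ℂ} (hu : ∀ I, Continuous (u I)) :
    ‖toForm q hu‖ ^ 2 = ∫ p, ‖coeffs q u p‖ ^ 2 ∂(ballMeasure n) := by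
  have h1 : inner ℂ (toForm q hu) (toForm q hu) = ((‖toForm q hu‖ ^ 2 : ℝ) : ℂ) := by
    rw [inner_self_eq_norm_sq_to_K]; norm_cast
  rw [L2.inner_def] at h1
  have h2 : ∫ p, inner ℂ (toForm q hu p) (toForm q hu p) ∂(ballMeasure n) =
      ∫ p, ((‖coeffs q u p‖ ^ 2 : ℝ) : ℂ) ∂(ballMeasure n) := by
    refine integral_congr_ae ?_
    filter_upwards [coeFn_toForm q hu] with p hp
    rw [hp, inner_self_eq_norm_sq_to_K]; norm_cast
  rw [h2, integral_complex_ofReal] at h1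
  exact_mod_cast h1.symm

lemma norm_sq_hFun (k : ℕ) (ζ : ℂ) : ‖hFun k ζ‖ ^ 2 = (8 * k + 2) * ‖ζ‖ ^ (8 * k) := by
  rw [hFun, norm_mul, norm_pow, Complex.norm_real, Real.norm_of_nonneg (Real.sqrt_nonneg _),
    mul_pow, Real.sq_sqrt (by positivity), ← pow_mul]
  congr 2; ring

lemma norm_sq_coeffs_mul (q : ℕ) (h : Heis n → ℂ) (v : Finset (Fin n) → Heis n → ℂ) (p : Heis n) :
    ‖coeffs q (fun I p => h p * v I p) p‖ ^ 2 = ‖h p‖ ^ 2 * ‖coeffs q v p‖ ^ 2 := by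
  have : coeffs q (fun I p => h p * v I p) p = h p • coeffs q v p := by
    ext I; simp [coeffs]
  rw [this, norm_smul, mul_pow]

lemma norm_sq_toForm_hFun (q k : ℕ) {v : Finset (Fin n) → Heis n → ℂ}
    (hu : ∀ I, Continuous fun p => hFun k (wFun p) * v I p) :
    ‖toForm q hu‖ ^ 2 =
      (8 * k + 2) * radialIntegral (fun p => ‖coeffs q v p‖ ^ 2) (8 * k) := by
  rw [norm_sq_toForm, radialIntegral, ← integral_const_mul]
  congr 1 with p
  rw [norm_sq_coeffs_mul, norm_sq_hFun, mul_assoc]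

lemma exists_norm_toForm_hFun_le (q : ℕ) {v : Finset (Fin n) → Heis n → ℂ}
    (hv : ∀ I, Continuous (v I)) :
    ∃ C : ℝ, ∀ (k : ℕ) (hu : ∀ I, Continuous fun p => hFun k (wFun p) * v I p),
      ‖toForm q hu‖ ≤ C := by
  obtain ⟨M, hM⟩ := (isCompact_ball n).exists_bound_of_continuousOn
    (continuous_coeffs q hv).continuousOn
  -- An upper bound needs no homogeneity of `v`: its coefficients are dominated on the ball by a
  -- constant, which is homogeneous of degree `0`.
  let ρ : Heis n → ℝ := fun _ => M ^ 2
  have hρ : Continuous ρ := continuous_const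
  have h0 : ∀ p, 0 ≤ ρ p := fun p => sq_nonneg M
  have hd : ∀ r p, 0 < r → ρ (dilation r p) = r ^ 0 * ρ p := fun r p _ => by simp [ρ]
  refine ⟨√((((0 : ℕ) : ℝ) + (2 * n + 2)) * radialIntegral ρ 0), fun k hu => ?_⟩
  refine Real.le_sqrt_of_sq_le ((norm_sq_toForm_hFun q k hu).le.trans
    (le_trans ?_ (radialIntegral_bounds hρ h0 hd k).2))
  refine mul_le_mul_of_nonneg_left ?_ (by positivity)
  refine setIntegral_mono_on (integrableOn_ball ((continuous_coeffs q hv).norm.pow 2) _)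
    (integrableOn_ball hρ _) (isClosed_ball n).measurableSet fun p hp => ?_
  exact mul_le_mul_of_nonneg_left (pow_le_pow_left₀ (norm_nonneg _) (hM p hp) 2) (by positivity)

lemma radialIntegral_zero_pos {ρ : Heis n → ℝ} (hρ : Continuous ρ) (h0 : ∀ p, 0 ≤ ρ p)
    {p : Heis n} (hp : p ∈ interior (ball n)) (hp0 : ρ p ≠ 0) : 0 < radialIntegral ρ 0 := by
  have h1 : radialIntegral ρ 0 = ∫ p in ball n, ρ p := by simp [radialIntegral, ballMeasure]
  rw [h1, setIntegral_pos_iff_support_of_nonneg_ae (.of_forall h0)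
    (by simpa using integrableOn_ball hρ 0)]
  have ho : IsOpen (Function.support ρ ∩ interior (ball n)) :=
    (hρ.isOpen_support).inter isOpen_interior
  exact (ho.measure_pos volume ⟨p, hp0, hp⟩).trans_le
    (measure_mono (Set.inter_subset_inter_right _ interior_subset))

/-- Geometric decay of `|ζ|^{8k}` beats the linear factor `8k + 2` in the squared norm. -/
lemma tendsto_hFun {ζ : ℂ} (hζ : ‖ζ‖ < 1) : Tendsto (fun k => hFun k ζ) atTop (𝓝 0) := by
  rw [tendsto_zero_iff_norm_tendsto_zero]
  have h1 : Tendsto (fun k => ‖hFun k ζ‖ ^ 2) atTop (𝓝 0) := by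
    simp only [norm_sq_hFun]
    have h2 : ‖ζ‖ ^ 8 < 1 := pow_lt_one₀ (norm_nonneg _) hζ (by norm_num)
    have h3 := tendsto_self_mul_const_pow_of_lt_one (by positivity) h2
    have h4 := tendsto_pow_atTop_nhds_zero_of_lt_one (by positivity) h2
    have h5 := (h3.const_mul 8).add (h4.const_mul 2)
    simp only [mul_zero, add_zero] at h5
    refine h5.congr fun k => ?_
    rw [← pow_mul]; ring
  have := h1.sqrt
  simpa [Real.sqrt_sq (norm_nonneg _)] using this

/-- A sequence `h_k(w) v` has no `L²`-convergent subsequence. -/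
lemma not_exists_tendsto_toForm_hFun [Nonempty (Fin n)] (q : ℕ) {v : Finset (Fin n) → Heis n → ℂ}
    (hv : ∀ I, Continuous (v I)) {d : ℕ}
    (hd : ∀ r p, 0 < r → ‖coeffs q v (dilation r p)‖ ^ 2 = r ^ d * ‖coeffs q v p‖ ^ 2)
    {p : Heis n} (hp : p ∈ interior (ball n)) (hp0 : coeffs q v p ≠ 0)
    (hu : ∀ k I, Continuous fun p => hFun k (wFun p) * v I p) :
    ¬ ∃ (m : ℕ → ℕ) (a : L2Form n q), StrictMono m ∧
      Tendsto (fun j => toForm q (hu (m j))) atTop (𝓝 a) := by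
  rintro ⟨m, a, hm, ha⟩
  obtain ⟨ns, hns, hae⟩ := (tendstoInMeasure_of_tendsto_Lp ha).exists_seq_tendsto_ae
  -- A further subsequence converges almost everywhere, and the pointwise limit is `0` wherever `|w|
  -- < 1`.
  have ha0 : a = 0 := by
    rw [Lp.eq_zero_iff_ae_eq_zero]
    filter_upwards [hae, ae_all_iff.2 fun k => coeFn_toForm q (hu k), ae_ballMeasure (n := n)]
      with p h1 h2 h3
    refine tendsto_nhds_unique h1 ?_
    have hw : ‖wFun p‖ < 1 := by
      rw [← sq_lt_one_iff₀ (norm_nonneg _), ← Complex.normSq_eq_norm_sq, wFun, mul_comm,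
        Complex.normSq_add_mul_I]
      exact h3.2
    have h4 := (((tendsto_hFun hw).comp hm.tendsto_atTop).comp hns.tendsto_atTop).smul_const
      (coeffs q v p)
    rw [zero_smul] at h4
    refine h4.congr fun i => ?_
    rw [h2]
    ext I; simp [coeffs]
  have hρ := (continuous_coeffs q hv).norm.pow 2
  have hpos := radialIntegral_zero_pos hρ (fun _ => sq_nonneg _) hp
    (pow_ne_zero 2 (norm_ne_zero_iff.2 hp0))
  -- The squared norms would tend to `0`, although each is at least the positive number
  -- `radialIntegral ρ 0`.
  have hlim := (ha.norm.pow 2)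
  rw [ha0, norm_zero, zero_pow two_ne_zero] at hlim
  refine absurd (ge_of_tendsto' hlim fun j => ?_) hpos.not_ge
  rw [norm_sq_toForm_hFun]
  exact (radialIntegral_bounds hρ (fun _ => sq_nonneg _) hd (m j)).1

/-! ### The Kohn Laplacian on forms annihilated by the Euler contraction -/

lemma toForm_congr (q : ℕ) {u v : Finset (Fin n) → Heis n → ℂ} (h : u = v)
    (hu : ∀ I, Continuous (u I)) (hv : ∀ I, Continuous (v I)) : toForm q hu = toForm q hv := by
  subst h; rfl

lemma toForm_eq_zero (q : ℕ) {u : Finset (Fin n) → Heis n → ℂ} (hu : ∀ I, Continuous (u I))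
    (h : ∀ I p, u I p = 0) : toForm q hu = 0 := by
  rw [Lp.eq_zero_iff_ae_eq_zero]
  filter_upwards [coeFn_toForm q hu] with p hp
  rw [hp]
  ext I
  simp [coeffs, h]

/-- Membership in `ker X` puts both `u` and `∂̄_b u` in the domain of the relevant adjoint. The
summand `∂̄_b ∂̄_b* u` is zero, leaving the formal adjoint of `g`. -/
lemma exists_kohnLaplacian_toForm [Nonempty (Fin n)] (q : ℕ) {u g : Finset (Fin n) → Heis n → ℂ}
    (hu : ∀ I, ContDiff ℝ 1 (u I)) (hu' : ∀ I p, sFun p ≠ 0 → ContDiffAt ℝ ∞ (u I) p)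
    (hXu : ∀ p, intMul (fun k => conj (p.2 k)) (fun K => u K p) = 0)
    (hcu : ∀ I p, codiffCoeff u I p = 0)
    (hg : ∀ I, ContDiff ℝ 1 (g I)) (hg' : ∀ I p, sFun p ≠ 0 → ContDiffAt ℝ ∞ (g I) p)
    (hXg : ∀ p, intMul (fun k => conj (p.2 k)) (fun K => g K p) = 0)
    (hug : dbarCoeff u = g) :
    ∃ x : (kohnLaplacian n (q + 1)).domain,
      (x : L2Form n (q + 1)) = toForm (q + 1) (fun I => (hu I).continuous) ∧
      kohnLaplacian n (q + 1) x = toForm (q + 1) (continuous_codiffCoeff hg) := by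
  obtain ⟨h1, e1⟩ := toForm_mem_adjoint q hu hu' hXu
  rw [toForm_eq_zero q (continuous_codiffCoeff hu) hcu] at e1
  have hgr := toForm_mem_dbar_graph (q + 1) hu
  rw [toForm_congr (q + 1 + 1) hug (continuous_dbarCoeff hu) fun I => (hg I).continuous] at hgr
  have h2 := LinearPMap.mem_domain_of_mem_graph hgr
  have e2 : dbar n (q + 1) ⟨_, h2⟩ = toForm (q + 1 + 1) fun I => (hg I).continuous :=
    ((LinearPMap.image_iff h2).2 hgr).symm
  obtain ⟨h3, e3⟩ := toForm_mem_adjoint (q + 1) hg hg' hXg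
  have h1' : (dbar n q).adjoint ⟨_, h1⟩ ∈ (dbar n q).domain := by rw [e1]; exact zero_mem _
  have h3' : dbar n (q + 1) ⟨_, h2⟩ ∈ (dbar n (q + 1)).adjoint.domain := by rw [e2]; exact h3
  refine ⟨⟨_, ⟨⟨h1, h1'⟩, ⟨h2, h3'⟩⟩⟩, rfl, ?_⟩
  change dbar n q ⟨(dbar n q).adjoint ⟨_, h1⟩, h1'⟩ +
    (dbar n (q + 1)).adjoint ⟨dbar n (q + 1) ⟨_, h2⟩, h3'⟩ = _
  have e4 : dbar n q ⟨(dbar n q).adjoint ⟨_, h1⟩, h1'⟩ = 0 := by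
    rw [show (⟨(dbar n q).adjoint ⟨_, h1⟩, h1'⟩ : (dbar n q).domain) = 0 from Subtype.ext e1,
      LinearPMap.map_zero]
  have e5 : (⟨dbar n (q + 1) ⟨_, h2⟩, h3'⟩ : (dbar n (q + 1)).adjoint.domain) = ⟨_, h3⟩ :=
    Subtype.ext e2
  rw [e4, e5, e3, zero_add]

/-! ### Multiplication by a `CR` function of `w` -/

lemma contDiff_hFun_wFun (k : ℕ) {m : WithTop ℕ∞} :
    ContDiff ℝ m (fun p : Heis n => hFun k (wFun p)) :=
  contDiff_const.mul (contDiff_wFun.pow _)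

lemma differentiableAt_wFun (p : Heis n) : DifferentiableAt ℝ wFun p :=
  (contDiff_wFun (m := 1)).differentiable one_ne_zero p

lemma differentiableAt_hFun_wFun (k : ℕ) (p : Heis n) :
    DifferentiableAt ℝ (fun p : Heis n => hFun k (wFun p)) p :=
  (contDiff_hFun_wFun k (m := 1)).differentiable one_ne_zero p

lemma Lbar_hFun_wFun (k : ℕ) (i : Fin n) (p : Heis n) :
    Lbar i (fun p => hFun k (wFun p)) p = 0 := by
  unfold hFun
  rw [Lbar_const_mul _ ((differentiableAt_wFun p).fun_pow _), Lbar_pow _ (differentiableAt_wFun p),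
    Lbar_w]
  simp

lemma exists_Lbar_conj_hFun_wFun (k : ℕ) (p : Heis n) :
    ∃ c : ℂ, ∀ i, Lbar i (fun p => conj (hFun k (wFun p))) p = c * p.2 i := by
  have d := differentiableAt_conj (differentiableAt_wFun p)
  refine ⟨(Real.sqrt (8 * k + 2) : ℂ) * ((4 * k : ℕ) * conj (wFun p) ^ (4 * k - 1) *
    -(2 * Complex.I)), fun i => ?_⟩
  unfold hFun
  simp only [map_mul, map_pow, Complex.conj_ofReal]
  rw [Lbar_const_mul _ (d.fun_pow _), Lbar_pow _ d, Lbar_conj_w]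
  ring

lemma dbarCoeff_hFun_mul (k : ℕ) {v : Finset (Fin n) → Heis n → ℂ} (hv : ∀ I, ContDiff ℝ 1 (v I)) :
    dbarCoeff (fun I p => hFun k (wFun p) * v I p) =
      fun I p => hFun k (wFun p) * dbarCoeff v I p := by
  ext K p
  have h : ∀ i I, Lbar i (fun p => hFun k (wFun p) * v I p) p = hFun k (wFun p) * Lbar i (v I) p := by
    intro i I
    rw [Lbar_mul (differentiableAt_hFun_wFun k p) ((hv I).differentiable one_ne_zero p),
      Lbar_hFun_wFun, mul_zero, add_zero]
  simp only [dbarCoeff, h, wedge_mul, Finset.mul_sum]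

/-- The function `conj (h_k(w))` is not CR, but its derivatives are proportional to `zᵏ`; after
conjugation the extra term is a multiple of the Euler contraction of `v`, which vanishes. -/
lemma codiffCoeff_hFun_mul (k : ℕ) {v : Finset (Fin n) → Heis n → ℂ}
    (hv : ∀ I, ContDiff ℝ 1 (v I)) (hX : ∀ p, intMul (fun k => conj (p.2 k)) (fun K => v K p) = 0) :
    codiffCoeff (fun I p => hFun k (wFun p) * v I p) =
      fun I p => hFun k (wFun p) * codiffCoeff v I p := by
  ext I p
  obtain ⟨c, hc⟩ := exists_Lbar_conj_hFun_wFun k p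
  have h : ∀ i K, conj (Lbar i (fun p => conj (hFun k (wFun p) * v K p)) p) =
      hFun k (wFun p) * conj (Lbar i (fun p => conj (v K p)) p) +
        conj c * conj (p.2 i) * v K p := by
    intro i K
    simp only [map_mul]
    rw [Lbar_mul (differentiableAt_conj (differentiableAt_hFun_wFun k p))
      (differentiableAt_conj ((hv K).differentiable one_ne_zero p)), hc]
    simp only [map_add, map_mul, Complex.conj_conj]
    ring
  have h2 : ∑ i, conj c * conj (p.2 i) * contr i (fun K => v K p) I = 0 := by
    have := congrFun (hX p) I
    simp only [mul_assoc, ← Finset.mul_sum]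
    rw [show ∑ i, conj (p.2 i) * contr i (fun K => v K p) I = 0 from this, mul_zero]
  simp only [codiffCoeff, h, contr_add, contr_mul, Finset.sum_add_distrib, h2, add_zero,
    ← Finset.mul_sum, mul_neg]

lemma intMul_mul (a : Fin n → ℂ) (c : ℂ) (F : Finset (Fin n) → ℂ) :
    intMul a (fun K => c * F K) = fun I => c * intMul a F I := by
  ext I
  simp only [intMul, contr_mul, Finset.mul_sum]
  exact Finset.sum_congr rfl fun k _ => by ring

/-! ### The forms `(z^N)^l s^{-m} ξ` -/

lemma contDiff_contr_of_forall {r : WithTop ℕ∞} {F : Finset (Fin n) → Heis n → ℂ}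
    (hF : ∀ K, ContDiff ℝ r (F K)) (k : Fin n) (I : Finset (Fin n)) :
    ContDiff ℝ r (fun p => contr k (fun K => F K p) I) := by
  unfold contr
  split_ifs
  · exact contDiff_const
  · exact contDiff_const.mul (hF _)

lemma contDiff_intMul {r : WithTop ℕ∞} {F : Finset (Fin n) → Heis n → ℂ}
    (hF : ∀ K, ContDiff ℝ r (F K)) (I : Finset (Fin n)) :
    ContDiff ℝ r (fun p : Heis n => intMul (fun k => conj (p.2 k)) (fun K => F K p) I) := by
  unfold intMul
  exact ContDiff.sum fun k _ => (contDiff_conj (contDiff_z k)).mul (contDiff_contr_of_forall hF k I)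

lemma contDiff_extMul {r : WithTop ℕ∞} {F : Finset (Fin n) → Heis n → ℂ}
    (hF : ∀ K, ContDiff ℝ r (F K)) (I : Finset (Fin n)) :
    ContDiff ℝ r (fun p : Heis n => extMul p.2 (fun K => F K p) I) := by
  unfold extMul wedge
  refine ContDiff.sum fun k _ => (contDiff_z k).mul ?_
  split_ifs
  · exact contDiff_const.mul (hF _)
  · exact contDiff_const

/-- The coefficients of `ξ^J`, indexed by all finite sets. -/
noncomputable def xiCoeff (J I : Finset (Fin n)) (p : Heis n) : ℂ :=
  intMul (fun k => conj (p.2 k)) (basisForm J) I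

lemma contDiff_xiCoeff (J I : Finset (Fin n)) {r : WithTop ℕ∞} : ContDiff ℝ r (xiCoeff J I) :=
  contDiff_intMul (F := fun K _ => basisForm J K) (fun _ => contDiff_const) I

/-- The coefficients of `ξ^J` are linear in the `z̄ᵏ`, so the derivative reads off one of them. -/
lemma Lbar_xiCoeff (k : Fin n) (J I : Finset (Fin n)) (p : Heis n) :
    Lbar k (xiCoeff J I) p = contr k (basisForm J) I := by
  have d : ∀ i, DifferentiableAt ℝ (fun p : Heis n => conj (p.2 i)) p := fun i =>
    differentiableAt_conj (differentiableAt_z i p)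
  unfold xiCoeff intMul
  simp only [mul_comm (conj _)]
  rw [Lbar_sum fun i _ => (d i).const_mul _]
  simp only [Lbar_const_mul _ (d _), Lbar_conj_z]
  simp

lemma conj_contr_basisForm (k : Fin n) (J I : Finset (Fin n)) :
    conj (contr k (basisForm J) I) = contr k (basisForm J) I := by
  rw [← contr_conj]
  congr 1
  ext K
  unfold basisForm
  split_ifs <;> simp

lemma Lbar_conj_xiCoeff (k : Fin n) (J I : Finset (Fin n)) (p : Heis n) :
    Lbar k (fun p => conj (xiCoeff J I p)) p = 0 := by
  unfold xiCoeff intMul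
  simp only [map_sum, map_mul, Complex.conj_conj, conj_contr_basisForm, mul_comm _ (contr _ _ _)]
  rw [Lbar_sum fun i _ => (differentiableAt_z i p).const_mul _]
  simp only [Lbar_const_mul _ (differentiableAt_z _ p), Lbar_z]
  simp

/-- The coefficients of `(z^N)^l s^{-m} ξ^J`. -/
noncomputable def uCoeff (N : Fin n) (l m : ℕ) (J I : Finset (Fin n)) (p : Heis n) : ℂ :=
  zPowDiv N l m p * xiCoeff J I p

/-- The coefficients of `∂̄_b ((z^N)^l s^{-m} ξ^J)` for `m = #J`. -/
noncomputable def duCoeff (N : Fin n) (l m : ℕ) (J K : Finset (Fin n)) (p : Heis n) : ℂ :=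
  m * zPowDiv N l (m + 1) p * intMul (fun k => conj (p.2 k)) (extMul p.2 (basisForm J)) K

section

variable {N : Fin n} {l m : ℕ} {J : Finset (Fin n)}

lemma contDiff_uCoeff (h : 2 * m + 3 ≤ l) (I : Finset (Fin n)) :
    ContDiff ℝ 1 (uCoeff N l m J I) :=
  (contDiff_zPowDiv N h).mul (contDiff_xiCoeff J I)

lemma contDiffAt_uCoeff (I : Finset (Fin n)) {p : Heis n} (hp : sFun p ≠ 0) :
    ContDiffAt ℝ ∞ (uCoeff N l m J I) p :=
  (contDiffAt_zPowDiv N l m hp).mul (contDiff_xiCoeff J I).contDiffAt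

lemma contDiff_duCoeff (h : 2 * m + 5 ≤ l) (I : Finset (Fin n)) :
    ContDiff ℝ 1 (duCoeff N l m J I) :=
  (contDiff_const.mul (contDiff_zPowDiv N (by lia))).mul
    (contDiff_intMul (contDiff_extMul fun _ => contDiff_const) I)

lemma contDiffAt_duCoeff (I : Finset (Fin n)) {p : Heis n} (hp : sFun p ≠ 0) :
    ContDiffAt ℝ ∞ (duCoeff N l m J I) p :=
  (contDiffAt_const.mul (contDiffAt_zPowDiv N l _ hp)).mul
    (contDiff_intMul (contDiff_extMul fun _ => contDiff_const) I).contDiffAt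

lemma intMul_uCoeff (p : Heis n) :
    intMul (fun k => conj (p.2 k)) (fun K => uCoeff N l m J K p) = 0 := by
  unfold uCoeff
  rw [intMul_mul]
  ext I
  have := congrFun (intMul_intMul (fun k => conj (p.2 k)) (basisForm J)) I
  simp only [xiCoeff]
  rw [show intMul (fun k => conj (p.2 k)) (fun K => intMul (fun k => conj (p.2 k)) (basisForm J) K) I
    = 0 from this, mul_zero]
  rfl

lemma intMul_duCoeff (p : Heis n) :
    intMul (fun k => conj (p.2 k)) (fun K => duCoeff N l m J K p) = 0 := by
  unfold duCoeff
  rw [intMul_mul]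
  ext I
  have := congrFun (intMul_intMul (fun k => conj (p.2 k)) (extMul p.2 (basisForm J))) I
  rw [show intMul (fun k => conj (p.2 k))
    (fun K => intMul (fun k => conj (p.2 k)) (extMul p.2 (basisForm J)) K) I = 0 from this, mul_zero]
  rfl

/-- For `m ≠ 0` this holds even at `s = 0`, where both sides are `0` by the convention for division.
-/
lemma zPowDiv_eq_sFun_mul (hm : m ≠ 0) (p : Heis n) :
    zPowDiv N l m p = sFun p * zPowDiv N l (m + 1) p := by
  unfold zPowDiv
  by_cases hp : (sFun p : ℂ) = 0
  · simp [hp, hm]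
  · field_simp
    ring

/-- The exponent `m = #J` is chosen for this. The derivative of `ξ^J` gives `m s^{-m} dz̄^J`, that
of `s^{-m}` gives `-m s^{-m-1} θ ∧ X dz̄^J`, and `s - θ ∧ X = X(θ ∧ ·)` combines the two into a form
in the image of `X`. -/
lemma dbarCoeff_uCoeff (h : 2 * m + 3 ≤ l) (hm : m ≠ 0) (hJ : J.card = m) :
    dbarCoeff (uCoeff N l m J) = duCoeff N l m J := by
  ext K p
  have h1 : ∀ k I, Lbar k (uCoeff N l m J I) p = zPowDiv N l m p * contr k (basisForm J) I +
      -(m * zPowDiv N l (m + 1) p) * (p.2 k * xiCoeff J I p) := by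
    intro k I
    unfold uCoeff
    rw [Lbar_mul (differentiableAt_zPowDiv N h p)
      ((contDiff_xiCoeff J I (r := 1)).differentiable one_ne_zero p), Lbar_xiCoeff,
      Lbar_zPowDiv k N h]
    ring
  have h2 := sum_wedge_basisForm J K
  have h3 := intMul_extMul (fun k => conj (p.2 k)) p.2 (basisForm J) K
  have h4 : ∑ k, conj (p.2 k) * p.2 k = (sFun p : ℂ) := by
    rw [sFun_eq_sum]; exact Finset.sum_congr rfl fun k _ => mul_comm _ _
  rw [h4] at h3
  have h5 : ∑ k, p.2 k * wedge k (fun I => xiCoeff J I p) K =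
    extMul p.2 (intMul (fun k => conj (p.2 k)) (basisForm J)) K := rfl
  simp only [dbarCoeff, h1, wedge_add, wedge_mul, Finset.sum_add_distrib, ← Finset.mul_sum]
  rw [h5, duCoeff, h2, hJ, zPowDiv_eq_sFun_mul hm]
  linear_combination (-(m * zPowDiv N l (m + 1) p)) * h3

lemma contr_basisForm_eq_zero (hN : N ∉ J) (I : Finset (Fin n)) : contr N (basisForm J) I = 0 := by
  unfold contr basisForm
  split_ifs with h1 h2
  · rfl
  · exact absurd (h2 ▸ Finset.mem_insert_self N I) hN
  · simp

lemma contr_xiCoeff_eq_zero (hN : N ∉ J) (I : Finset (Fin n)) (p : Heis n) :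
    contr N (fun K => xiCoeff J K p) I = 0 := by
  unfold xiCoeff intMul
  rw [contr_sum]
  refine Finset.sum_eq_zero fun k _ => ?_
  have h : contr k (contr N (basisForm J)) I = 0 := by
    rw [show contr N (basisForm J) = fun _ => 0 from funext (contr_basisForm_eq_zero hN)]
    unfold contr
    simp
  rw [contr_mul, show contr N (fun K => contr k (basisForm J) K) I = _ from
    contr_contr N k (basisForm J) I, h]
  simp

/-- Conjugated, the coefficients of `ξ^J` are CR. Differentiating the power of `z^N` produces
contraction with `∂/∂z̄^N`, which kills `ξ^J` since `N ∉ J`; differentiating `s^{-m}` produces the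
Euler contraction, zero by `X² = 0`. -/
lemma codiffCoeff_uCoeff (h : 2 * m + 3 ≤ l) (hN : N ∉ J) (I : Finset (Fin n)) (p : Heis n) :
    codiffCoeff (uCoeff N l m J) I p = 0 := by
  have h1 : ∀ k K, conj (Lbar k (fun p => conj (uCoeff N l m J K p)) p) =
      (if k = N then l * zPowDiv N (l - 1) m p else 0) * xiCoeff J K p +
        -(m * zPowDiv N l (m + 1) p * conj (p.2 k)) * xiCoeff J K p := by
    intro k K
    unfold uCoeff
    simp only [map_mul]
    rw [Lbar_mul (differentiableAt_conj (differentiableAt_zPowDiv N h p))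
      (differentiableAt_conj ((contDiff_xiCoeff J K (r := 1)).differentiable one_ne_zero p)),
      Lbar_conj_xiCoeff, Lbar_conj_zPowDiv k N h]
    split_ifs <;> simp <;> ring
  have h2 : ∑ k, conj (p.2 k) * contr k (fun K => xiCoeff J K p) I = 0 :=
    congrFun (intMul_intMul (fun k => conj (p.2 k)) (basisForm J)) I
  have h3 : ∀ k, (if k = N then l * zPowDiv N (l - 1) m p else 0) *
      contr k (fun K => xiCoeff J K p) I = 0 := by
    intro k
    split_ifs with hk
    · rw [hk, contr_xiCoeff_eq_zero hN, mul_zero]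
    · rw [zero_mul]
  simp only [codiffCoeff, h1, contr_add, contr_mul, h3, zero_add]
  simp only [neg_mul, mul_assoc, Finset.sum_neg_distrib, ← Finset.mul_sum, h2]
  simp

lemma uCoeff_dilation (h : 2 * m ≤ l) {r : ℝ} (hr : 0 < r) (I : Finset (Fin n)) (p : Heis n) :
    uCoeff N l m J I (dilation r p) = (r : ℂ) ^ (l - 2 * m + 1) * uCoeff N l m J I p := by
  have hr' : (r : ℂ) ≠ 0 := by simpa using hr.ne'
  have h1 : zPowDiv N l m (dilation r p) = (r : ℂ) ^ (l - 2 * m) * zPowDiv N l m p := by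
    obtain ⟨a, rfl⟩ := Nat.exists_eq_add_of_le h
    rw [zPowDiv, zPowDiv, sFun_dilation, Nat.add_sub_cancel_left]
    have : (dilation r p).2 N = r * p.2 N := by simp [dilation]
    rw [this]
    push_cast
    rw [mul_pow, mul_pow, ← pow_mul, pow_add (r : ℂ), mul_assoc, mul_div_mul_left _ _
      (pow_ne_zero _ hr'), mul_div_assoc]
  have h2 : xiCoeff J I (dilation r p) = r * xiCoeff J I p := by
    unfold xiCoeff intMul
    rw [Finset.mul_sum]
    refine Finset.sum_congr rfl fun k _ => ?_
    simp [dilation, mul_assoc]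
  rw [uCoeff, h1, h2, uCoeff, pow_succ]
  ring

end

/-- It suffices to take `t = 0` and `z` supported on the coordinates `j ∈ J` and `N`, with entries
`1/2` keeping `s ≤ 1/2`; the coefficient at `J \ j` is then nonzero. -/
lemma exists_uCoeff_ne_zero {N : Fin n} {J : Finset (Fin n)} {q : ℕ} (hJ : J.card = q + 1)
    (l m : ℕ) : ∃ p ∈ interior (ball n), coeffs q (uCoeff N l m J) p ≠ 0 := by
  obtain ⟨j, hj⟩ := Finset.card_pos.1 (show 0 < J.card by lia)
  let p : Heis n := (0, fun k => if k = j ∨ k = N then 1 / 2 else 0)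
  have hpj : p.2 j = 1 / 2 := by simp [p]
  have hpN : p.2 N = 1 / 2 := by simp [p]
  have hs : sFun p ≤ 1 / 2 := by
    have h1 : ∀ k, ‖p.2 k‖ ^ 2 ≤ (if k = j then 1 / 4 else 0) + (if k = N then 1 / 4 else 0) := by
      intro k
      by_cases h1 : k = j
      · subst h1
        rw [hpj]
        split_ifs <;> norm_num at *
      · by_cases h2 : k = N
        · subst h2
          rw [hpN]
          split_ifs <;> norm_num at *
        · simp [p, h1, h2]
    refine (Finset.sum_le_sum fun k _ => h1 k).trans ?_
    rw [Finset.sum_add_distrib]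
    simp
    norm_num
  have hs0 : 0 < sFun p := lt_of_lt_of_le (by rw [hpj]; norm_num) (norm_sq_le_sFun p j)
  refine ⟨p, mem_interior_ball ?_, fun h0 => ?_⟩
  · have : p.1 = 0 := rfl
    rw [this]; nlinarith
  · have h1 := congrArg (fun x : EuclideanSpace ℂ (MultiIndex n q) =>
      x ⟨J.erase j, by rw [Finset.card_erase_of_mem hj, hJ]; rfl⟩) h0
    have h2 : uCoeff N l m J (J.erase j) p = 0 := h1
    have h3 : xiCoeff J (J.erase j) p = 1 / 2 * sign j J := by
      rw [xiCoeff, intMul, Finset.sum_eq_single j]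
      · simp [contr, basisForm, Finset.insert_erase hj, sign_erase hj, hpj, Complex.conj_ofNat]
      · intro k _ hk
        rw [contr, basisForm]
        split_ifs with h3 h4
        · simp
        · have : j ∈ insert k (J.erase j) := h4.symm.subset hj
          simp [hk.symm] at this
        · simp
      · simp
    have h4 : sign j J ≠ 0 := fun h => by simpa [h] using sign_mul_self j J
    have h5 : zPowDiv N l m p ≠ 0 := by
      rw [zPowDiv, hpN]
      exact div_ne_zero (pow_ne_zero _ (by norm_num)) (pow_ne_zero _ (by exact_mod_cast hs0.ne'))
    rw [uCoeff, h3] at h2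
    exact mul_ne_zero h5 (mul_ne_zero (by norm_num) h4) h2

lemma norm_sq_coeffs_uCoeff_dilation {N : Fin n} {l m : ℕ} {J : Finset (Fin n)} (q : ℕ)
    (h : 2 * m ≤ l) {r : ℝ} (hr : 0 < r) (p : Heis n) :
    ‖coeffs q (uCoeff N l m J) (dilation r p)‖ ^ 2 =
      r ^ (2 * (l - 2 * m + 1)) * ‖coeffs q (uCoeff N l m J) p‖ ^ 2 := by
  have h1 : coeffs q (uCoeff N l m J) (dilation r p) =
      ((r : ℂ) ^ (l - 2 * m + 1)) • coeffs q (uCoeff N l m J) p := by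
    ext I
    simp [coeffs, uCoeff_dilation h hr]
  rw [h1, norm_smul, norm_pow, Complex.norm_real, Real.norm_of_nonneg hr.le, mul_pow, ← pow_mul,
    mul_comm _ 2]

/-! ### Assembly: the sequence of forms and the failure of compactness -/

lemma uForm_eq_coeffs (q : ℕ) (hqn : q + 2 ≤ n) (l : ℕ) (h : ℂ → ℂ) :
    uForm n q hqn l h = coeffs q fun I p =>
      h (wFun p) * uCoeff ⟨n - 1, by lia⟩ l (q + 1) (firstIndices n q hqn).1 I p := by
  ext p I
  simp only [uForm, coeffs, uCoeff, zPowDiv, xiCoeff, xi_eq_intMul]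
  ring

lemma last_notMem_firstIndices (q : ℕ) (hqn : q + 2 ≤ n) :
    (⟨n - 1, by lia⟩ : Fin n) ∉ (firstIndices n q hqn).1 := by
  simp only [firstIndices, Finset.mem_map, Finset.mem_univ, true_and, not_exists]
  intro i hi
  have := congrArg Fin.val hi
  simp at this
  lia

/-- The sequence `u_{h_k}` is bounded in the graph norm of `□_b` and has no convergent
subsequence. -/
lemma exists_seq_kohnLaplacian (q : ℕ) (hq : 1 ≤ q) (hqn : q + 2 ≤ n) (l : ℕ)
    (hl : 2 * (q + 1) + 5 ≤ l) :
    ∃ u : ℕ → (kohnLaplacian n q).domain,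
      (∀ k, (u k : L2Form n q) =ᵐ[ballMeasure n] uForm n q hqn l (hFun k)) ∧
      (∃ C : ℝ, ∀ k, ‖kohnLaplacian n q (u k)‖ ≤ C) ∧
      ¬ ∃ (m : ℕ → ℕ) (a : L2Form n q), StrictMono m ∧
        Tendsto (fun j => (u (m j) : L2Form n q)) atTop (𝓝 a) := by
  -- Positive degree selects the two-term Laplacian. After this shift `m = #J` is `q + 1 + 1`.
  obtain ⟨q, rfl⟩ := Nat.exists_eq_add_of_le' hq
  let N : Fin n := ⟨n - 1, by lia⟩
  have : Nonempty (Fin n) := ⟨N⟩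
  let J := firstIndices n (q + 1) hqn
  have hN : N ∉ J.1 := last_notMem_firstIndices (q + 1) hqn
  let v := uCoeff N l (q + 1 + 1) J.1
  let g := duCoeff N l (q + 1 + 1) J.1
  have hv : ∀ I, ContDiff ℝ 1 (v I) := contDiff_uCoeff (by lia)
  -- This fixes the threshold on `l`: the coefficients of `g` contain `s^{-(m+1)}`, so being `C¹`
  -- costs `2(m + 1) + 3 = 2m + 5`.
  have hg : ∀ I, ContDiff ℝ 1 (g I) := contDiff_duCoeff (by lia)
  have hvg : dbarCoeff v = g := dbarCoeff_uCoeff (by lia) (by lia) J.2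
  have hXv : ∀ p, intMul (fun k => conj (p.2 k)) (fun K => v K p) = 0 := intMul_uCoeff
  have hXg : ∀ p, intMul (fun k => conj (p.2 k)) (fun K => g K p) = 0 := intMul_duCoeff
  have hXh : ∀ (k : ℕ) {f : Finset (Fin n) → Heis n → ℂ},
      (∀ p, intMul (fun k => conj (p.2 k)) (fun K => f K p) = 0) →
      ∀ p, intMul (fun k => conj (p.2 k)) (fun K => hFun k (wFun p) * f K p) = 0 := by
    intro k f hf p
    rw [intMul_mul, hf p]
    ext I; simp
  have hu : ∀ k I, ContDiff ℝ 1 fun p => hFun k (wFun p) * v I p := fun k I =>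
    (contDiff_hFun_wFun k).mul (hv I)
  have hhg : ∀ k I, ContDiff ℝ 1 fun p => hFun k (wFun p) * g I p := fun k I =>
    (contDiff_hFun_wFun k).mul (hg I)
  have key := fun k => exists_kohnLaplacian_toForm q (hu k)
    (fun I p hp => (contDiff_hFun_wFun k).contDiffAt.mul (contDiffAt_uCoeff I hp)) (hXh k hXv)
    (fun I p => by
      rw [codiffCoeff_hFun_mul k hv hXv]
      exact mul_eq_zero_of_right _ (codiffCoeff_uCoeff (by lia) hN I p))
    (hhg k) (fun I p hp => (contDiff_hFun_wFun k).contDiffAt.mul (contDiffAt_duCoeff I hp))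
    (hXh k hXg) (by rw [dbarCoeff_hFun_mul k hv, hvg])
  choose u hu1 hu2 using key
  refine ⟨u, fun k => ?_, ?_, ?_⟩
  · rw [hu1, uForm_eq_coeffs]
    exact coeFn_toForm _ _
  -- The image of each form is `h_k(w)` times one fixed continuous form, so a single constant works
  -- for all `k`.
  · obtain ⟨C, hC⟩ := exists_norm_toForm_hFun_le (q + 1) (continuous_codiffCoeff hg)
    refine ⟨C, fun k => ?_⟩
    have hc : ∀ I, Continuous fun p => hFun k (wFun p) * codiffCoeff g I p := fun I =>
      (contDiff_hFun_wFun k (m := 0)).continuous.mul (continuous_codiffCoeff hg I)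
    rw [hu2, toForm_congr (q + 1) (codiffCoeff_hFun_mul k hg hXg) _ hc]
    exact hC k hc
  · simp only [hu1]
    obtain ⟨p, hp, hp0⟩ := exists_uCoeff_ne_zero (N := N) J.2 l (q + 1 + 1)
    exact not_exists_tendsto_toForm_hFun (q + 1) (fun I => (hv I).continuous)
      (fun r p hr => norm_sq_coeffs_uCoeff_dilation (q + 1) (by lia) hr p) hp hp0
      fun k I => (hu k I).continuous

/-- An inverse of an operator `A` is not compact if `A` is bounded along a sequence without
convergent subsequences. -/
lemma IsNeumannOperator.not_isCompactOperator {F : Type*} [NormedAddCommGroup F]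
    [InnerProductSpace ℂ F] [CompleteSpace F] {A : F →ₗ.[ℂ] F} {N : F →L[ℂ] F}
    (hN : IsNeumannOperator A N) {u : ℕ → A.domain} {C : ℝ} (hC : ∀ k, ‖A (u k)‖ ≤ C)
    (hu : ¬ ∃ (m : ℕ → ℕ) (a : F), StrictMono m ∧ Tendsto (fun j => (u (m j) : F)) atTop (𝓝 a)) :
    ¬ IsCompactOperator N := by
  intro hc
  have hK := hc.isCompact_closure_image_closedBall (f := (N : F →ₗ[ℂ] F)) C
  -- Left inversion gives `u k = N (A (u k))`, so the sequence stays in the image of a ball, which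
  -- is relatively compact if `N` is compact.
  have hmem : ∀ k, (u k : F) ∈ closure ((N : F →ₗ[ℂ] F) '' Metric.closedBall 0 C) := fun k =>
    subset_closure ⟨A (u k), by simpa using hC k, hN.left_inv (u k)⟩
  obtain ⟨a, -, m, hm, ha⟩ := hK.tendsto_subseq hmem
  exact hu ⟨m, a, hm, ha⟩

end Heisenberg

theorem theorem2 (n q : ℕ) (hq : 1 ≤ q) (hqn : q + 2 ≤ n) :
    (∀ N : Heisenberg.L2Form n q →L[ℂ] Heisenberg.L2Form n q,
      Heisenberg.IsNeumannOperator (Heisenberg.kohnLaplacian n q) N → ¬ IsCompactOperator N) ∧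
    ∃ l₀ : ℕ, ∀ l ≥ l₀, ∃ u : ℕ → (Heisenberg.kohnLaplacian n q).domain,
      (∀ k, ((u k : Heisenberg.L2Form n q) :
          Heisenberg.Heis n → EuclideanSpace ℂ (Heisenberg.MultiIndex n q))
        =ᵐ[Heisenberg.ballMeasure n] Heisenberg.uForm n q hqn l (Heisenberg.hFun k)) ∧
      (∃ C : ℝ, ∀ k, ‖Heisenberg.kohnLaplacian n q (u k)‖ ≤ C) ∧
      ¬ ∃ (m : ℕ → ℕ) (a : Heisenberg.L2Form n q), StrictMono m ∧
        Tendsto (fun j => (u (m j) : Heisenberg.L2Form n q)) atTop (𝓝 a) := by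
  have h := fun l hl => Heisenberg.exists_seq_kohnLaplacian (n := n) q hq hqn l hl
  refine ⟨fun N hN => ?_, 2 * (q + 1) + 5, h⟩
  obtain ⟨u, -, ⟨C, hC⟩, hu⟩ := h _ le_rfl
  exact hN.not_isCompactOperator hC hu
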